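/- A state $\theta\in[0,1]$ is drawn from a prior with CDF $\mathcal M$ and a continuous, strictly positive density $\mu$ on $[0,1]$. Let $r>0$ and $0\le\underline\theta<1$, let the time space be $[0,H]$, and let the investor's (agent's) and the central bank's (principal's) indirect utilities, when the investor stops at time $t$ with posterior mean $m$, be $$U(m,t)=e^{-rt}\max\{m,\tfrac12\},\qquad V(m,t)=(m-\underline\theta)\,t .$$ The central bank chooses a càdlàg martingale $(X_t)$ of beliefs about $\theta$ (probability measures on $[0,1]$, with $\mathbb E[X_t]$ equal to the prior) on some filtered probability space, together with a stopping time $\tau\le H$, so as to maximize $\mathbb E[V(m_\tau,\tau)]$, where $m_t$ is the mean of $X_t$, subject to obedience: $\mathbb E[U(m_{\tau},\tau)]\ge \mathbb E[U(m_{\tau'},\tau')]$ for every stopping time $\tau'\le H$. A tail-censorship policy with endpoints $\alpha,\beta:[0,\overline T]\to[0,1]$ ($\alpha\le\beta$ continuous, $\alpha$ nonincreasing, $\beta$ nondecreasing, and the interval kept constant after $\overline T$) is the following policy: at time $t$ the belief is $\delta_\theta$ if $\theta\in[\alpha(t),\beta(t)]$, and is the prior conditioned on $\theta\notin[\alpha(t),\beta(t)]$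 otherwise; the agent's information is the filtration generated by this belief process; and $\tau$ is the first time at which $\theta\in[\alpha(t),\beta(t)]$. Then, given $\mu$ and $r$, there is $$\theta^*\in\Big[\tfrac12,\ \frac{1+\mathbb E[\theta\,\mathbf 1\{\theta<\frac12\}]}{1+\mathcal M(\frac12)}\Big]$$ such that for every $\underline\theta\in[0,1)$ there are $\overline T>0$ and such $\alpha,\beta$ on $[0,\overline T]$, with $\alpha(t)<\frac12$ for $t\in(0,\overline T]$, satisfying $$\alpha'(t)=-\frac{\mathcal M(\alpha(t))+1-\mathcal M(\beta(t))}{\mu(\alpha(t))\,(\frac12-\alpha(t))}\,r\,\beta(t),\qquad \beta'(t)=\frac{\beta(t)-\alpha(t)}{\frac12-\alpha(t)}\,r\,\beta(t)$$ at every $t\in[0,\overline T]$ with $\alpha(t)<\frac12$ (hence at every $t\in(0,\overline T]$; one-sided derivatives at the two ends), with $\alpha(\overline T)=0$, $\beta(\overline T)=1$ and $\beta(0)=\max\{\underline\theta,\theta^*\}$, and such that for every horizon $H\ge\overline T$ the tail-censorship policy with endpoints $\alpha,\beta$ solves the central bank's problem. -/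

import Mathlib

open MeasureTheory ProbabilityTheory Set Filter Topology
open scoped NNReal unitInterval

universe u

noncomputable section

namespace CentralBank

/-! The state space is `Θ = [0,1]` (the type `I`), time is `ℝ≥0`. -/

/-- The cumulative distribution function of the prior with density `μ` on `[0,1]`. -/
def cdf (μ : ℝ → ℝ) (x : ℝ) : ℝ := ∫ z in (0 : ℝ)..x, μ z

/-- The prior on `[0,1]` with density `μ` with respect to Lebesgue measure. -/
def prior (μ : ℝ → ℝ) : Measure I :=
  (volume : Measure I).withDensity fun θ => ENNReal.ofReal (μ θ)

/-- The mean of a belief `ν` on `[0,1]`. -/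
def mean (ν : Measure I) : ℝ := ∫ θ, (θ : ℝ) ∂ν

/-- The agent's indirect utility `U(m,t) = exp (-r t) * max {m, 1/2}`. -/
def agentU (r m t : ℝ) : ℝ := Real.exp (-r * t) * max m (1 / 2)

/-- The principal's indirect utility `V(m,t) = (m - θlow) * t`. -/
def principalV (θlow m t : ℝ) : ℝ := (m - θlow) * t

section Model

variable {Ω : Type*} [mΩ : MeasurableSpace Ω]

/-- The agent's expected payoff when the belief process is `X` and he stops at `τ`. -/
def agentPayoff (r : ℝ) (P : Measure Ω) (X : ℝ≥0 → Ω → Measure I) (τ : Ω → ℝ≥0) : ℝ :=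
  ∫ ω, agentU r (mean (X (τ ω) ω)) (τ ω) ∂P

/-- The principal's expected payoff when the belief process is `X` and the agent stops at `τ`. -/
def principalPayoff (θlow : ℝ) (P : Measure Ω) (X : ℝ≥0 → Ω → Measure I) (τ : Ω → ℝ≥0) : ℝ :=
  ∫ ω, principalV θlow (mean (X (τ ω) ω)) (τ ω) ∂P

/-- A persuasion strategy for the prior `μ₀`: a process `X` of beliefs (probability measures on
`[0,1]`) on a filtered probability space, which is a martingale with mean `μ₀` and has cadlag
paths for the weak topology. Both properties are expressed through the integrals of continuous
test functions. The belief at time `0` may already be random. -/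
structure IsPersuasionStrategy (μ₀ : Measure I) (P : Measure Ω) (ℱ : Filtration ℝ≥0 mΩ)
    (X : ℝ≥0 → Ω → Measure I) : Prop where
  isProbabilityMeasure : IsProbabilityMeasure P
  isBelief : ∀ t ω, IsProbabilityMeasure (X t ω)
  martingale : ∀ φ : C(I, ℝ), Martingale (fun t ω => ∫ θ, φ θ ∂(X t ω)) ℱ P
  rightContinuous : ∀ (φ : C(I, ℝ)) (ω : Ω) (t : ℝ≥0),
    ContinuousWithinAt (fun s => ∫ θ, φ θ ∂(X s ω)) (Ici t) t
  leftLimits : ∀ (φ : C(I, ℝ)) (ω : Ω) (t : ℝ≥0),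
    ∃ l : ℝ, Tendsto (fun s => ∫ θ, φ θ ∂(X s ω)) (𝓝[<] t) (𝓝 l)
  bayesPlausible : ∀ φ : C(I, ℝ), ∫ ω, ∫ θ, φ θ ∂(X 0 ω) ∂P = ∫ θ, φ θ ∂μ₀

/-- `τ` is a stopping time with values in the time space `[0,H]`. -/
def IsStoppingRule (H : ℝ≥0) (ℱ : Filtration ℝ≥0 mΩ) (τ : Ω → ℝ≥0) : Prop :=
  IsStoppingTime ℱ (fun ω => ((τ ω : ℝ≥0) : WithTop ℝ≥0)) ∧ ∀ ω, τ ω ≤ H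

/-- The obedience constraint: `τ` is a stopping rule that maximizes the agent's expected payoff
among all stopping rules. -/
def IsObedient (r : ℝ) (H : ℝ≥0) (P : Measure Ω) (ℱ : Filtration ℝ≥0 mΩ)
    (X : ℝ≥0 → Ω → Measure I) (τ : Ω → ℝ≥0) : Prop :=
  IsStoppingRule H ℱ τ ∧
    ∀ τ' : Ω → ℝ≥0, IsStoppingRule H ℱ τ' → agentPayoff r P X τ' ≤ agentPayoff r P X τ

/-- `(X, τ)` solves the principal's problem with time space `[0,H]`: it is feasible and obedient,
and no feasible and obedient pair, on any filtered probability space, gives the principal a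
larger expected payoff. -/
def IsOptimalPolicy (μ₀ : Measure I) (r θlow : ℝ) (H : ℝ≥0) (P : Measure Ω)
    (ℱ : Filtration ℝ≥0 mΩ) (X : ℝ≥0 → Ω → Measure I) (τ : Ω → ℝ≥0) : Prop :=
  IsPersuasionStrategy μ₀ P ℱ X ∧ IsObedient r H P ℱ X τ ∧
    ∀ (Ω' : Type u) [mΩ' : MeasurableSpace Ω'] (P' : Measure Ω') (ℱ' : Filtration ℝ≥0 mΩ')
      (X' : ℝ≥0 → Ω' → Measure I) (τ' : Ω' → ℝ≥0),
      IsPersuasionStrategy μ₀ P' ℱ' X' → IsObedient r H P' ℱ' X' τ' →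
        principalPayoff θlow P' X' τ' ≤ principalPayoff θlow P X τ

end Model

section TailCensorship

/-- `[α(t), β(t)]`, `0 ≤ t ≤ Tbar`, is a continuously expanding family of subintervals
of `[0,1]`. -/
structure IsExpandingInterval (α β : ℝ → ℝ) (Tbar : ℝ) : Prop where
  continuousOn_lower : ContinuousOn α (Icc 0 Tbar)
  continuousOn_upper : ContinuousOn β (Icc 0 Tbar)
  antitoneOn_lower : AntitoneOn α (Icc 0 Tbar)
  monotoneOn_upper : MonotoneOn β (Icc 0 Tbar)
  ordered : ∀ t ∈ Icc 0 Tbar, 0 ≤ α t ∧ α t ≤ β t ∧ β t ≤ 1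

/-- The set of states revealed up to time `t`. The interval stays constant after `Tbar`. -/
def revealed (α β : ℝ → ℝ) (Tbar : ℝ) (t : ℝ≥0) : Set I :=
  {θ | α (min (t : ℝ) Tbar) ≤ θ ∧ (θ : ℝ) ≤ β (min (t : ℝ) Tbar)}

theorem measurableSet_revealed (α β : ℝ → ℝ) (Tbar : ℝ) (t : ℝ≥0) :
    MeasurableSet (revealed α β Tbar t) :=
  (measurableSet_le measurable_const measurable_subtype_coe).inter
    (measurableSet_le measurable_subtype_coe measurable_const)

open Classical in
/-- The belief at time `t` under tail-censorship when the true state is `θ`: the state is known if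
it lies in the revealed set, and otherwise silence means that it lies in one of the tails, so the
belief is the prior `μ₀` conditioned on the complement of the revealed set. -/
def tailBelief (μ₀ : Measure I) (α β : ℝ → ℝ) (Tbar : ℝ) (t : ℝ≥0) (θ : I) : Measure I :=
  if θ ∈ revealed α β Tbar t then Measure.dirac θ else ProbabilityTheory.cond μ₀ (revealed α β Tbar t)ᶜ

theorem measurable_tailBelief (μ₀ : Measure I) (α β : ℝ → ℝ) (Tbar : ℝ) (t : ℝ≥0) :
    Measurable (tailBelief μ₀ α β Tbar t) := by
  classical
  unfold tailBelief
  exact Measurable.ite (measurableSet_revealed α β Tbar t) Measure.measurable_dirac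
    measurable_const

/-- The information of the agent under tail-censorship: the filtration generated by the belief
process, on the sample space `[0,1]` of states. -/
def tailFiltration (μ₀ : Measure I) (α β : ℝ → ℝ) (Tbar : ℝ) :
    Filtration ℝ≥0 (inferInstance : MeasurableSpace I) where
  seq t := ⨆ s : Iic t, MeasurableSpace.comap (tailBelief μ₀ α β Tbar s) inferInstance
  mono' _ _ h := iSup_le fun s =>
    le_iSup_of_le (⟨s.1, le_trans s.2 h⟩ : Iic _) le_rfl
  le' _ := iSup_le fun s => (measurable_tailBelief μ₀ α β Tbar s).comap_le

/-- The first time at which the state `θ` is revealed. -/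
def revealTime (α β : ℝ → ℝ) (Tbar : ℝ) (θ : I) : ℝ≥0 :=
  sInf {t : ℝ≥0 | θ ∈ revealed α β Tbar t}

/-- The endpoints solve the differential equations on `[0,Tbar]` (with one-sided derivatives at the
two ends). The lower endpoint is below `1/2` after time `0`; if it equals `1/2` at time `0`, where
the right-hand sides are singular, nothing is asked at that time. -/
def SolvesSystem (μ : ℝ → ℝ) (r : ℝ) (α β : ℝ → ℝ) (Tbar : ℝ) : Prop :=
  (∀ t ∈ Ioc 0 Tbar, α t < 1 / 2) ∧
  ∀ t ∈ Icc 0 Tbar, α t < 1 / 2 →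
    HasDerivWithinAt α
      (-((cdf μ (α t) + 1 - cdf μ (β t)) / (μ (α t) * (1 / 2 - α t))) * r * β t)
      (Icc 0 Tbar) t ∧
    HasDerivWithinAt β ((β t - α t) / (1 / 2 - α t) * r * β t) (Icc 0 Tbar) t

end TailCensorship

end CentralBank

end

/-!
The proof is by Lagrangian duality for a relaxed problem, with the policy built backwards from the
condition that the agent is always indifferent.

**The policy.** Let `b` be the mean of the prior on the tails `[0,a] ∪ [b,1]`, that is
`tailExcess μ a b = 0`. This determines `a` as a decreasing function of `b` with `a = 0` at `b = 1`.
Following that curve at the speed that the differential equations prescribe is a separable problem: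
the time needed to reach `b` is an explicit integral, and its inverse is `β`
(`exists_silenceCurve`). The threshold `θ*` is the level at which the curve reaches `a = 1/2`, or
`1/2` if it has not done so by then (`exists_threshold`). Along the curve the posterior mean after
silence is `β t`, and the differential equation for `α` says that continuing is then worth exactly
`β t` to the agent (`IsSilenceCurve.setIntegral_silent_agentU`). Since censored states cannot be
told apart, a deviation amounts to choosing a date at which to stop after silence, so indifference
is obedience (`IsSilenceCurve.isObedient`).

**The upper bound.** For any obedient policy, optional stopping applied to the deviations `min τ t`
and `0` gives linear constraints on the joint law of the final mean and the stopping time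
(`IsObedient.continuation_le`, `IsObedient.initial_le`). Weighting them with the multiplier
`shadowDensity` and an atom at time `0` gives a Lagrangian `L(m, t)` that dominates the principal's
payoff in expectation. `L` is convex in `m`, and for a fixed mean `m` it increases in `t` until `m`
enters `[α t, β t]` and decreases afterwards
(`IsSilenceCurve.lagrangian_le_revealTime`). Hence `h θ = max_t L(θ, t)` satisfies
`L(m_τ, τ) ≤ ∫ h dX_τ`, and the right-hand side has expectation `∫ h` under the prior by the
martingale property. Tail-censorship stops each state at its maximiser and all weighted constraints
bind, so its payoff is `∫ h` (`IsSilenceCurve.principalPayoff_le`).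
-/

namespace CentralBank

variable {μ : ℝ → ℝ}

/-! ### Roots of equations depending on a parameter -/

/-- Carathéodory's form of implicit differentiation. -/
theorem hasDerivWithinAt_of_mul_eq {g c d : ℝ → ℝ} {s : Set ℝ} {y₀ p q : ℝ}
    (h : ∀ y ∈ s, (g y - g y₀) * c y = (y - y₀) * d y)
    (hc : Tendsto c (𝓝[s] y₀) (𝓝 p)) (hp : p ≠ 0) (hd : Tendsto d (𝓝[s] y₀) (𝓝 q)) :
    HasDerivWithinAt g (q / p) s y₀ := by
  rw [hasDerivWithinAt_iff_tendsto_slope]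
  have hle : 𝓝[s \ {y₀}] y₀ ≤ 𝓝[s] y₀ := nhdsWithin_mono _ sdiff_subset
  refine ((hd.mono_left hle).div (hc.mono_left hle) hp).congr' ?_
  filter_upwards [self_mem_nhdsWithin, (hc.mono_left hle).eventually_ne hp] with y hy hcy
  have hne : y - y₀ ≠ 0 := sub_ne_zero.2 (by simpa using hy.2)
  rw [slope_def_field, Pi.div_apply, div_eq_div_iff hcy hne]
  linarith [h y hy.1]

/-- The root of a function that is strictly decreasing in the unknown and continuous in the
parameter depends continuously on the parameter. -/
theorem continuousOn_root {Φ : ℝ → ℝ → ℝ} {g : ℝ → ℝ} {s : Set ℝ} {lo hi : ℝ}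
    (hΦ : ∀ x ∈ Icc lo hi, ContinuousOn (Φ x) s)
    (hanti : ∀ y ∈ s, StrictAntiOn (fun x => Φ x y) (Icc lo hi))
    (hg : ∀ y ∈ s, g y ∈ Icc lo hi) (hroot : ∀ y ∈ s, Φ (g y) y = 0) : ContinuousOn g s := by
  intro y₀ hy₀
  refine tendsto_order.2 ⟨fun x hx => ?_, fun x hx => ?_⟩
  · rcases lt_or_ge x lo with hlo | hlo
    · filter_upwards [self_mem_nhdsWithin] with y hy using hlo.trans_le (hg y hy).1
    have hxI : x ∈ Icc lo hi := ⟨hlo, hx.le.trans (hg y₀ hy₀).2⟩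
    have hpos : 0 < Φ x y₀ := hroot y₀ hy₀ ▸ hanti y₀ hy₀ hxI (hg y₀ hy₀) hx
    filter_upwards [self_mem_nhdsWithin, (hΦ x hxI y₀ hy₀).eventually_const_lt hpos] with y hy h
    by_contra! hle
    exact absurd ((hanti y hy).antitoneOn (hg y hy) hxI hle) (by simpa [hroot y hy] using h)
  · rcases lt_or_ge hi x with hhi | hhi
    · filter_upwards [self_mem_nhdsWithin] with y hy using (hg y hy).2.trans_lt hhi
    have hxI : x ∈ Icc lo hi := ⟨(hg y₀ hy₀).1.trans hx.le, hhi⟩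
    have hneg : Φ x y₀ < 0 := hroot y₀ hy₀ ▸ hanti y₀ hy₀ (hg y₀ hy₀) hxI hx
    filter_upwards [self_mem_nhdsWithin, (hΦ x hxI y₀ hy₀).eventually_lt_const hneg] with y hy h
    by_contra! hle
    exact absurd ((hanti y hy).antitoneOn hxI (hg y hy) hle) (by simpa [hroot y hy] using h)

/-! ### The mean of the censored tails -/

/-- The first moment of the prior up to `x`. -/
noncomputable def firstMoment (μ : ℝ → ℝ) (x : ℝ) : ℝ := ∫ z in (0 : ℝ)..x, z * μ z

/-- The excess over `b` of the prior mean on the tails `[0,a] ∪ [b,1]`, not normalised by the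
mass of the tails. It vanishes exactly if `b` is the posterior mean after silence. -/
noncomputable def tailExcess (μ : ℝ → ℝ) (a b : ℝ) : ℝ :=
  (∫ z in (0 : ℝ)..a, (z - b) * μ z) + ∫ z in b..1, (z - b) * μ z

theorem hasDerivAt_cdf (hc : Continuous μ) (x : ℝ) : HasDerivAt (cdf μ) (μ x) x :=
  hc.integral_hasStrictDerivAt 0 x |>.hasDerivAt

theorem hasDerivAt_firstMoment (hc : Continuous μ) (x : ℝ) :
    HasDerivAt (firstMoment μ) (x * μ x) x :=
  (continuous_id.mul hc).integral_hasStrictDerivAt 0 x |>.hasDerivAt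

theorem integral_sub_mul (hc : Continuous μ) (a b c : ℝ) :
    ∫ z in a..b, (z - c) * μ z =
      firstMoment μ b - firstMoment μ a - c * (cdf μ b - cdf μ a) := by
  have i1 : ∀ u v : ℝ, IntervalIntegrable (fun z => z * μ z) volume u v :=
    fun u v => (continuous_id.mul hc).intervalIntegrable u v
  have i2 : ∀ u v : ℝ, IntervalIntegrable μ volume u v := fun u v => hc.intervalIntegrable u v
  simp only [firstMoment, cdf, sub_mul]
  rw [intervalIntegral.integral_interval_sub_left (i1 _ _) (i1 _ _),
    intervalIntegral.integral_interval_sub_left (i2 _ _) (i2 _ _),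
    intervalIntegral.integral_sub (i1 _ _) ((i2 _ _).const_mul c),
    intervalIntegral.integral_const_mul]

theorem cdf_zero : cdf μ 0 = 0 := intervalIntegral.integral_same

theorem firstMoment_zero : firstMoment μ 0 = 0 := intervalIntegral.integral_same

theorem cdf_strictMono (hc : Continuous μ) (hp : ∀ x, 0 < μ x) : StrictMono (cdf μ) :=
  strictMono_of_deriv_pos fun x => by rw [(hasDerivAt_cdf hc x).deriv]; exact hp x

theorem tailExcess_eq (hc : Continuous μ) (h1 : cdf μ 1 = 1) (a b : ℝ) :
    tailExcess μ a b =
      firstMoment μ a - b * cdf μ a + (firstMoment μ 1 - firstMoment μ b) - b * (1 - cdf μ b) := by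
  rw [tailExcess, integral_sub_mul hc, integral_sub_mul hc, cdf_zero, firstMoment_zero, h1]
  ring

theorem hasDerivAt_tailExcess_right (hc : Continuous μ) (h1 : cdf μ 1 = 1) (a b : ℝ) :
    HasDerivAt (tailExcess μ a) (-(cdf μ a + 1 - cdf μ b)) b := by
  have e : tailExcess μ a = fun b => firstMoment μ a - b * cdf μ a +
      (firstMoment μ 1 - firstMoment μ b) - b * (1 - cdf μ b) :=
    funext fun b => tailExcess_eq hc h1 a b
  rw [e]
  have hM := hasDerivAt_firstMoment hc b
  have hF := hasDerivAt_cdf hc b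
  have hid := hasDerivAt_id b
  exact ((((hid.mul_const (cdf μ a)).const_sub (firstMoment μ a)).add
    (hM.const_sub (firstMoment μ 1))).sub (hid.mul (hF.const_sub 1))).congr_deriv
    (by simp only [id]; ring)

theorem hasDerivAt_tailExcess_left (hc : Continuous μ) (h1 : cdf μ 1 = 1) (a b : ℝ) :
    HasDerivAt (fun a => tailExcess μ a b) ((a - b) * μ a) a := by
  simp only [tailExcess_eq hc h1]
  have hM := hasDerivAt_firstMoment hc a
  have hF := hasDerivAt_cdf hc a
  exact (((hM.sub (hF.const_mul b)).add_const (firstMoment μ 1 - firstMoment μ b)).sub_const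
    (b * (1 - cdf μ b))).congr_deriv (by ring)

theorem continuous_tailExcess_right (hc : Continuous μ) (h1 : cdf μ 1 = 1) (a : ℝ) :
    Continuous (tailExcess μ a) :=
  continuous_iff_continuousAt.2 fun b => (hasDerivAt_tailExcess_right hc h1 a b).continuousAt

theorem continuous_tailExcess_left (hc : Continuous μ) (h1 : cdf μ 1 = 1) (b : ℝ) :
    Continuous fun a => tailExcess μ a b :=
  continuous_iff_continuousAt.2 fun a => (hasDerivAt_tailExcess_left hc h1 a b).continuousAt

theorem tailExcess_strictAntiOn_left (hc : Continuous μ) (hp : ∀ x, 0 < μ x) (h1 : cdf μ 1 = 1)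
    (b : ℝ) : StrictAntiOn (fun a => tailExcess μ a b) (Iic b) := by
  refine strictAntiOn_of_deriv_neg (convex_Iic b)
    (continuous_tailExcess_left hc h1 b).continuousOn fun a ha => ?_
  rw [(hasDerivAt_tailExcess_left hc h1 a b).deriv]
  rw [interior_Iic, mem_Iio] at ha
  exact mul_neg_of_neg_of_pos (by linarith) (hp a)

theorem tailExcess_antitoneOn_right (hc : Continuous μ) (hp : ∀ x, 0 < μ x) (h1 : cdf μ 1 = 1)
    {a : ℝ} (ha : 0 ≤ a) : AntitoneOn (tailExcess μ a) (Iic 1) := by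
  refine antitoneOn_of_deriv_nonpos (convex_Iic 1)
    (continuous_tailExcess_right hc h1 a).continuousOn
    (fun b _ => (hasDerivAt_tailExcess_right hc h1 a b).differentiableAt.differentiableWithinAt)
    fun b hb => ?_
  rw [(hasDerivAt_tailExcess_right hc h1 a b).deriv]
  rw [interior_Iic, mem_Iio] at hb
  have h := (cdf_strictMono hc hp).monotone ha
  have h' := (cdf_strictMono hc hp).monotone hb.le
  rw [cdf_zero] at h
  rw [h1] at h'
  linarith

theorem tailExcess_zero_left_nonneg (hp : ∀ x, 0 < μ x) {b : ℝ} (hb : b ≤ 1) :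
    0 ≤ tailExcess μ 0 b := by
  rw [tailExcess, intervalIntegral.integral_same, zero_add]
  exact intervalIntegral.integral_nonneg hb fun z hz =>
    mul_nonneg (by linarith [hz.1]) (hp z).le

theorem tailExcess_zero_one : tailExcess μ 0 1 = 0 := by
  simp [tailExcess]

theorem tailExcess_half_one_neg (hc : Continuous μ) (hp : ∀ x, 0 < μ x) (h1 : cdf μ 1 = 1) :
    tailExcess μ (1 / 2) 1 < 0 :=
  tailExcess_zero_one (μ := μ) ▸ tailExcess_strictAntiOn_left hc hp h1 1
    (by norm_num) (by norm_num) (by norm_num)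

/-- The threshold `θ*` is `1/2` if the prior mean is at most `1/2`; otherwise it is the level `b`
at which revealing `[1/2, b]` makes `b` the posterior mean after silence. -/
theorem exists_threshold (hc : Continuous μ) (hp : ∀ x, 0 < μ x) (h1 : cdf μ 1 = 1) :
    ∃ θs ∈ Icc (1 / 2 : ℝ) ((1 + firstMoment μ (1 / 2)) / (1 + cdf μ (1 / 2))),
      θs < 1 ∧ tailExcess μ (1 / 2) θs ≤ 0 ∧ (θs = 1 / 2 ∨ tailExcess μ (1 / 2) θs = 0) := by
  have hM0 : 0 < cdf μ (1 / 2) := by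
    simpa [cdf_zero] using cdf_strictMono hc hp (show (0 : ℝ) < 1 / 2 by norm_num)
  have hM1 : cdf μ (1 / 2) < 1 := by
    simpa [h1] using cdf_strictMono hc hp (show (1 / 2 : ℝ) < 1 by norm_num)
  have hE : 0 ≤ firstMoment μ (1 / 2) := intervalIntegral.integral_nonneg (by norm_num)
    fun z hz => mul_nonneg hz.1 (hp z).le
  rcases le_or_gt (tailExcess μ (1 / 2) (1 / 2)) 0 with h | h
  · refine ⟨1 / 2, ⟨le_rfl, ?_⟩, by norm_num, h, Or.inl rfl⟩
    rw [le_div_iff₀ (by linarith)]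
    linarith
  · obtain ⟨b, hb, hb0⟩ : ∃ b ∈ Icc (1 / 2 : ℝ) 1, tailExcess μ (1 / 2) b = 0 :=
      intermediate_value_Icc' (by norm_num) (continuous_tailExcess_right hc h1 _).continuousOn
        ⟨(tailExcess_half_one_neg hc hp h1).le, h.le⟩
    have hb1 : b < 1 := lt_of_le_of_ne hb.2 fun e =>
      (tailExcess_half_one_neg hc hp h1).ne (e ▸ hb0)
    refine ⟨b, ⟨hb.1, ?_⟩, hb1, hb0.le, Or.inr hb0⟩
    -- The upper tail contributes at most `(1 - b) * (1 - M b) ≤ 1 - b` to the excess.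
    have hup : ∫ z in b..1, (z - b) * μ z ≤ ∫ z in b..1, (1 - b) * μ z :=
      intervalIntegral.integral_mono_on hb.2
        (((continuous_id.sub continuous_const).mul hc).intervalIntegrable _ _)
        ((continuous_const.mul hc).intervalIntegrable _ _)
        fun z hz => mul_le_mul_of_nonneg_right (by linarith [hz.2]) (hp z).le
    have hlow := integral_sub_mul hc 0 (1 / 2) b
    rw [intervalIntegral.integral_const_mul] at hup
    have hmass : ∫ z in b..1, μ z = 1 - cdf μ b := by
      have := intervalIntegral.integral_interval_sub_left (hc.intervalIntegrable (μ := volume) 0 1)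
        (hc.intervalIntegrable 0 b)
      rw [← this]; simpa [cdf] using h1
    have hMb : 0 ≤ cdf μ b := by
      simpa [cdf_zero] using (cdf_strictMono hc hp).monotone (show (0 : ℝ) ≤ b by linarith [hb.1])
    rw [tailExcess, hlow, cdf_zero, firstMoment_zero] at hb0
    rw [hmass] at hup
    rw [le_div_iff₀ (by linarith)]
    nlinarith

/-! ### The endpoints of the revealed interval -/

theorem tailExcess_half_neg (hc : Continuous μ) (hp : ∀ x, 0 < μ x) (h1 : cdf μ 1 = 1)
    {b₀ b : ℝ} (h0 : tailExcess μ (1 / 2) b₀ ≤ 0) (hb : b₀ < b) (hb1 : b ≤ 1) :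
    tailExcess μ (1 / 2) b < 0 := by
  refine lt_of_lt_of_le ?_ h0
  refine strictAntiOn_of_deriv_neg (convex_Iic 1)
    (continuous_tailExcess_right hc h1 (1 / 2)).continuousOn (fun b hb => ?_)
    (hb.le.trans hb1 : b₀ ∈ Iic (1 : ℝ)) hb1 hb
  rw [(hasDerivAt_tailExcess_right hc h1 (1 / 2) b).deriv]
  rw [interior_Iic, mem_Iio] at hb
  have h := cdf_strictMono hc hp (show (0 : ℝ) < 1 / 2 by norm_num)
  have h' := cdf_strictMono hc hp hb
  rw [cdf_zero] at h
  rw [h1] at h'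
  linarith

/-- As the upper endpoint `b` runs through `[b₀, 1]`, the lower endpoint `a b` for which `b` is the
mean of the tails falls to `0`; it is differentiable where it is below `1/2`. -/
theorem exists_lowerEndpoint (hc : Continuous μ) (hp : ∀ x, 0 < μ x) (h1 : cdf μ 1 = 1)
    {b₀ : ℝ} (hb₀ : 1 / 2 ≤ b₀) (hb₀1 : b₀ < 1) (h0 : tailExcess μ (1 / 2) b₀ ≤ 0) :
    ∃ a : ℝ → ℝ, (∀ b ∈ Icc b₀ 1, 0 ≤ a b ∧ a b ≤ 1 / 2 ∧ tailExcess μ (a b) b = 0) ∧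
      a 1 = 0 ∧ (tailExcess μ (1 / 2) b₀ = 0 → a b₀ = 1 / 2) ∧
      (∀ b ∈ Ioc b₀ 1, a b < 1 / 2) ∧
      AntitoneOn a (Icc b₀ 1) ∧ ContinuousOn a (Icc b₀ 1) ∧
      ∀ b ∈ Icc b₀ 1, a b < 1 / 2 →
        HasDerivWithinAt a ((cdf μ (a b) + 1 - cdf μ b) / ((a b - b) * μ (a b))) (Icc b₀ 1) b := by
  have hanti := tailExcess_strictAntiOn_left hc hp h1
  have key : ∀ b, ∃ a, b ∈ Icc b₀ 1 → 0 ≤ a ∧ a ≤ 1 / 2 ∧ tailExcess μ a b = 0 := by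
    intro b
    by_cases hb : b ∈ Icc b₀ 1
    · have hhalf : tailExcess μ (1 / 2) b ≤ 0 :=
        (tailExcess_antitoneOn_right hc hp h1 (by norm_num) hb₀1.le hb.2 hb.1).trans h0
      obtain ⟨a, ha, ha0⟩ := intermediate_value_Icc' (show (0 : ℝ) ≤ 1 / 2 by norm_num)
        (continuous_tailExcess_left hc h1 b).continuousOn
        ⟨hhalf, tailExcess_zero_left_nonneg hp hb.2⟩
      exact ⟨a, fun _ => ⟨ha.1, ha.2, ha0⟩⟩
    · exact ⟨0, fun h => absurd h hb⟩
  choose a ha using key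
  have hinj : ∀ b ∈ Icc b₀ 1, ∀ x ≤ 1 / 2, tailExcess μ x b = 0 → x = a b := fun b hb x hx hx0 =>
    (hanti b).injOn (hx.trans (hb₀.trans hb.1)) ((ha b hb).2.1.trans (hb₀.trans hb.1))
      (hx0.trans (ha b hb).2.2.symm)
  have hl : b₀ ∈ Icc b₀ 1 := ⟨le_rfl, hb₀1.le⟩
  have hr : (1 : ℝ) ∈ Icc b₀ 1 := ⟨hb₀1.le, le_rfl⟩
  have hcont : ContinuousOn a (Icc b₀ 1) := by
    refine continuousOn_root (Φ := tailExcess μ) (lo := 0) (hi := 1 / 2)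
      (fun x _ => (continuous_tailExcess_right hc h1 x).continuousOn)
      (fun b hb => (hanti b).mono fun x hx => hx.2.trans (hb₀.trans hb.1))
      (fun b hb => ⟨(ha b hb).1, (ha b hb).2.1⟩) fun b hb => (ha b hb).2.2
  refine ⟨a, ha, (hinj 1 hr 0 (by norm_num) tailExcess_zero_one).symm,
    fun h => (hinj b₀ hl _ le_rfl h).symm, fun b hb => ?_, fun b hb b' hb' hle => ?_, hcont,
    fun b hb hlt => ?_⟩
  · have hb' : b ∈ Icc b₀ 1 := ⟨hb.1.le, hb.2⟩
    refine lt_of_le_of_ne (ha b hb').2.1 fun e => ?_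
    exact (tailExcess_half_neg hc hp h1 h0 hb.1 hb.2).ne (e ▸ (ha b hb').2.2)
  · by_contra! hlt
    have h2 := (hanti b') ((ha b hb).2.1.trans (hb₀.trans hb'.1))
      ((ha b' hb').2.1.trans (hb₀.trans hb'.1)) hlt
    have h3 := tailExcess_antitoneOn_right hc hp h1 (ha b hb).1 hb.2 hb'.2 hle
    simp only [(ha b' hb').2.2] at h2
    rw [(ha b hb).2.2] at h3
    linarith
  · have hM := (hasDerivAt_firstMoment hc (a b))
    have hF := (hasDerivAt_cdf hc (a b))
    have hT := (hasDerivAt_tailExcess_right hc h1 (a b) b)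
    have cM := continuousAt_dslope_same.2 hM.differentiableAt
    have cF := continuousAt_dslope_same.2 hF.differentiableAt
    have cT := continuousAt_dslope_same.2 hT.differentiableAt
    have tM : Tendsto (fun y => dslope (firstMoment μ) (a b) (a y)) (𝓝[Icc b₀ 1] b)
        (𝓝 (a b * μ (a b))) := by
      have := cM.tendsto.comp (hcont b hb).tendsto
      rwa [dslope_same, hM.deriv] at this
    have tF : Tendsto (fun y => dslope (cdf μ) (a b) (a y)) (𝓝[Icc b₀ 1] b) (𝓝 (μ (a b))) := by
      have := cF.tendsto.comp (hcont b hb).tendsto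
      rwa [dslope_same, hF.deriv] at this
    have tT : Tendsto (fun y => -dslope (tailExcess μ (a b)) b y) (𝓝[Icc b₀ 1] b)
        (𝓝 (cdf μ (a b) + 1 - cdf μ b)) := by
      have := (cT.tendsto.mono_left (nhdsWithin_le_nhds (s := Icc b₀ 1))).neg
      rwa [dslope_same, hT.deriv, neg_neg] at this
    have tid : Tendsto (fun y : ℝ => y) (𝓝[Icc b₀ 1] b) (𝓝 b) := nhdsWithin_le_nhds
    refine hasDerivWithinAt_of_mul_eq (c := fun y => dslope (firstMoment μ) (a b) (a y) -
      y * dslope (cdf μ) (a b) (a y)) (d := fun y => -dslope (tailExcess μ (a b)) b y)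
      (fun y hy => ?_) (by simpa [sub_mul] using tM.sub (tid.mul tF)) ?_ tT
    · have e1 := sub_smul_dslope (firstMoment μ) (a b) (a y)
      have e2 := sub_smul_dslope (cdf μ) (a b) (a y)
      have e3 := sub_smul_dslope (tailExcess μ (a b)) b y
      have e4 := (ha y hy).2.2
      have e5 := (ha b hb).2.2
      rw [smul_eq_mul] at e1 e2 e3
      rw [tailExcess_eq hc h1] at e4
      rw [e5, tailExcess_eq hc h1] at e3
      linear_combination e1 - y * e2 + e3 + e4
    · exact mul_ne_zero (by linarith [hb.1]) (hp _).ne'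

/-- The data that the endpoints of the optimal tail-censorship policy carry. The last field says
that the posterior mean after silence is the upper endpoint. -/
structure IsSilenceCurve (μ : ℝ → ℝ) (r : ℝ) (α β : ℝ → ℝ) (T : ℝ) : Prop where
  pos : 0 < T
  expanding : IsExpandingInterval α β T
  solves : SolvesSystem μ r α β T
  lower_end : α T = 0
  upper_end : β T = 1
  lower_le_half : ∀ t ∈ Icc 0 T, α t ≤ 1 / 2
  half_le_upper : ∀ t ∈ Icc 0 T, 1 / 2 ≤ β t
  tailExcess_eq_zero : ∀ t ∈ Icc 0 T, tailExcess μ (α t) (β t) = 0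

/-- The time at which the upper endpoint reaches `b` is an integral of the reciprocal of its
speed; inverting it solves the differential equations without an existence theorem. -/
theorem exists_silenceCurve (hc : Continuous μ) (hp : ∀ x, 0 < μ x) (h1 : cdf μ 1 = 1)
    {r : ℝ} (hr : 0 < r) {b₀ : ℝ} (hb₀ : 1 / 2 ≤ b₀) (hb₀1 : b₀ < 1)
    (h0 : tailExcess μ (1 / 2) b₀ ≤ 0) :
    ∃ (T : ℝ) (α β : ℝ → ℝ), IsSilenceCurve μ r α β T ∧ β 0 = b₀ ∧
      (tailExcess μ (1 / 2) b₀ = 0 → α 0 = 1 / 2) := by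
  obtain ⟨a, ha, ha1, hahalf, halt, hamono, hacont, haderiv⟩ :=
    exists_lowerEndpoint hc hp h1 hb₀ hb₀1 h0
  set c : ℝ → ℝ := fun b => (projIcc b₀ 1 hb₀1.le b : ℝ) with hcdef
  have hcI : ∀ b, c b ∈ Icc b₀ 1 := fun b => (projIcc b₀ 1 hb₀1.le b).2
  have hcid : ∀ b ∈ Icc b₀ 1, c b = b := fun b hb => by
    simp only [hcdef, projIcc_of_mem hb₀1.le hb]
  have hcmono : Monotone c := fun x y h => monotone_projIcc hb₀1.le h
  have hccont : Continuous c := continuous_subtype_val.comp continuous_projIcc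
  have haccont : Continuous fun b => a (c b) :=
    hacont.comp_continuous hccont hcI
  set w : ℝ → ℝ := fun b => (1 / 2 - a (c b)) / ((c b - a (c b)) * (r * c b)) with hw
  have hdcont : Continuous fun b => (c b - a (c b)) * (r * c b) :=
    (hccont.sub haccont).mul (continuous_const.mul hccont)
  have hwm : Measurable w := (continuous_const.sub haccont).measurable.div hdcont.measurable
  have hw0 : ∀ b, 0 ≤ w b := fun b => by
    obtain ⟨h1, h2, -⟩ := ha _ (hcI b)
    have h3 := (hcI b).1
    exact div_nonneg (by linarith) (mul_nonneg (by linarith) (mul_nonneg hr.le (by linarith)))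
  have hwle : ∀ b, w b ≤ 2 / r := fun b => by
    obtain ⟨h1, h2, -⟩ := ha _ (hcI b)
    have h3 := (hcI b).1
    have e : w b = (1 / 2 - a (c b)) / (c b - a (c b)) * (1 / (r * c b)) := by
      simp only [hw]; rw [div_mul_div_comm, mul_one]
    have i1 : (1 / 2 - a (c b)) / (c b - a (c b)) ≤ 1 :=
      div_le_one_of_le₀ (by linarith) (by linarith)
    have i2 : 1 / (r * c b) ≤ 2 / r := by
      rw [div_le_div_iff₀ (by nlinarith) hr]; nlinarith
    have i3 : 0 ≤ 1 / (r * c b) := by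
      have : 0 < r * c b := by nlinarith
      positivity
    calc w b ≤ 1 * (1 / (r * c b)) := e ▸ mul_le_mul_of_nonneg_right i1 i3
      _ ≤ _ := by linarith
  have hwi : ∀ x y, IntervalIntegrable w volume x y := fun x y => by
    refine (intervalIntegrable_const (c := 2 / r)).mono_fun hwm.aestronglyMeasurable ?_
    refine ae_of_all _ fun b => ?_
    beta_reduce
    rw [Real.norm_of_nonneg (hw0 b), Real.norm_of_nonneg (by positivity)]
    exact hwle b
  have hwpos : ∀ b ∈ Icc b₀ 1, a b < 1 / 2 → 0 < w b := fun b hb h => by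
    simp only [hw, hcid b hb]
    have := hb.1
    exact div_pos (by linarith) (mul_pos (by linarith) (mul_pos hr (by linarith)))
  set tm : ℝ → ℝ := fun b => ∫ x in b₀..b, w x with htm
  have htmcont : Continuous tm := intervalIntegral.continuous_primitive hwi b₀
  have htmono : StrictMonoOn tm (Icc b₀ 1) := by
    intro x hx y hy hxy
    have e : tm y - tm x = ∫ z in x..y, w z :=
      intervalIntegral.integral_interval_sub_left (hwi _ _) (hwi _ _)
    have : 0 < ∫ z in x..y, w z := intervalIntegral.intervalIntegral_pos_of_pos_on (hwi _ _)
      (fun z hz => hwpos z ⟨hx.1.trans hz.1.le, hz.2.le.trans hy.2⟩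
        (halt z ⟨hx.1.trans_lt hz.1, hz.2.le.trans hy.2⟩)) hxy
    linarith
  have htm0 : tm b₀ = 0 := intervalIntegral.integral_same
  have hl : b₀ ∈ Icc b₀ 1 := ⟨le_rfl, hb₀1.le⟩
  have hrr : (1 : ℝ) ∈ Icc b₀ 1 := ⟨hb₀1.le, le_rfl⟩
  set T := tm 1 with hT
  have hTpos : 0 < T := htm0 ▸ htmono hl hrr hb₀1
  have key : ∀ t, ∃ b, t ∈ Icc 0 T → b ∈ Icc b₀ 1 ∧ tm b = t := by
    intro t
    by_cases ht : t ∈ Icc 0 T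
    · obtain ⟨b, hb, hbt⟩ := intermediate_value_Icc hb₀1.le htmcont.continuousOn
        (show t ∈ Icc (tm b₀) (tm 1) by rwa [htm0])
      exact ⟨b, fun _ => ⟨hb, hbt⟩⟩
    · exact ⟨0, fun h => absurd h ht⟩
  choose β hβ using key
  have hβ0 : β 0 = b₀ := htmono.injOn (hβ 0 ⟨le_rfl, hTpos.le⟩).1 hl
    ((hβ 0 ⟨le_rfl, hTpos.le⟩).2.trans htm0.symm)
  have hβT : β T = 1 := htmono.injOn (hβ T ⟨hTpos.le, le_rfl⟩).1 hrr
    ((hβ T ⟨hTpos.le, le_rfl⟩).2)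
  have hβmono : MonotoneOn β (Icc 0 T) := fun s hs t ht hst =>
    (htmono.le_iff_le (hβ s hs).1 (hβ t ht).1).1 (by rwa [(hβ s hs).2, (hβ t ht).2])
  have hβcont : ContinuousOn β (Icc 0 T) := by
    refine continuousOn_root (Φ := fun x t => t - tm x) (lo := b₀) (hi := 1)
      (fun x _ => by fun_prop)
      (fun t _ x hx y hy hxy => sub_lt_sub_left (htmono hx hy hxy) t) (fun t ht => (hβ t ht).1)
      fun t ht => by simp [(hβ t ht).2]
  have hβmaps : MapsTo β (Icc 0 T) (Icc b₀ 1) := fun t ht => (hβ t ht).1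
  have hβpos : ∀ t ∈ Ioc 0 T, b₀ < β t := fun t ht => by
    have ht' : t ∈ Icc 0 T := ⟨ht.1.le, ht.2⟩
    refine lt_of_le_of_ne (hβ t ht').1.1 fun e => ?_
    have := (hβ t ht').2
    rw [← e, htm0] at this
    exact ht.1.ne this
  have hβderiv : ∀ t ∈ Icc 0 T, a (β t) < 1 / 2 →
      HasDerivWithinAt β ((β t - a (β t)) / (1 / 2 - a (β t)) * r * β t) (Icc 0 T) t := by
    intro t ht hlt
    have hb := (hβ t ht).1
    have hwc : ContinuousAt w (β t) := by
      refine ContinuousAt.div (continuous_const.sub haccont).continuousAt hdcont.continuousAt ?_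
      rw [hcid _ hb]
      have := hb.1
      exact mul_ne_zero (by linarith) (mul_ne_zero hr.ne' (by linarith))
    have hd : HasDerivAt tm (w (β t)) (β t) := intervalIntegral.integral_hasDerivAt_right (hwi _ _)
      (hwm.stronglyMeasurable.stronglyMeasurableAtFilter) hwc
    have ct := continuousAt_dslope_same.2 hd.differentiableAt
    have tt : Tendsto (fun s => dslope tm (β t) (β s)) (𝓝[Icc 0 T] t) (𝓝 (w (β t))) := by
      have := ct.tendsto.comp (hβcont t ht).tendsto
      rwa [dslope_same, hd.deriv] at this
    have hfin : HasDerivWithinAt β (1 / w (β t)) (Icc 0 T) t := by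
      refine hasDerivWithinAt_of_mul_eq (d := fun _ => 1) (fun s hs => ?_) tt
        (hwpos _ hb hlt).ne' tendsto_const_nhds
      have := sub_smul_dslope tm (β t) (β s)
      rw [smul_eq_mul, (hβ s hs).2, (hβ t ht).2] at this
      rw [this, mul_one]
    refine hfin.congr_deriv ?_
    simp only [hw, hcid _ hb]
    rw [one_div_div]
    ring
  refine ⟨T, fun t => a (β t), β, ⟨hTpos, ⟨hacont.comp hβcont hβmaps, hβcont,
    fun s hs t ht hst => hamono (hβmaps hs) (hβmaps ht) (hβmono hs ht hst), hβmono, ?_⟩, ⟨?_, ?_⟩,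
    ?_, hβT, ?_, ?_, ?_⟩, hβ0, fun h => ?_⟩
  · intro t ht
    obtain ⟨h1, h2, -⟩ := ha _ (hβmaps ht)
    exact ⟨h1, by linarith [(hβmaps ht).1], (hβmaps ht).2⟩
  · exact fun t ht => halt _ ⟨hβpos t ht, (hβmaps ⟨ht.1.le, ht.2⟩).2⟩
  · intro t ht hlt
    refine ⟨?_, hβderiv t ht hlt⟩
    refine ((haderiv _ (hβmaps ht) hlt).comp t (hβderiv t ht hlt) hβmaps).congr_deriv ?_
    have hb := (hβmaps ht).1
    have n1 : β t - a (β t) ≠ 0 := by linarith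
    have n2 : a (β t) - β t ≠ 0 := by linarith
    have n3 : 1 / 2 - a (β t) ≠ 0 := by linarith
    have n4 := (hp (a (β t))).ne'
    rw [← neg_sub (β t) (a (β t))]
    field_simp
  · rw [hβT, ha1]
  · exact fun t ht => (ha _ (hβmaps ht)).2.1
  · exact fun t ht => hb₀.trans (hβmaps ht).1
  · exact fun t ht => (ha _ (hβmaps ht)).2.2
  · change a (β 0) = 1 / 2
    rw [hβ0, hahalf h]

/-! ### Integrals against the prior -/

theorem setIntegral_prior (hc : Continuous μ) (hp : ∀ x, 0 < μ x) (f : ℝ → ℝ) {s : Set ℝ}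
    (hs : MeasurableSet s) :
    ∫ θ in ((↑) : I → ℝ) ⁻¹' s, f θ ∂prior μ = ∫ x in s ∩ Icc 0 1, f x * μ x := by
  have hm : Measurable fun θ : I => ENNReal.ofReal (μ θ) :=
    (hc.measurable.comp measurable_subtype_coe).ennreal_ofReal
  rw [← integral_indicator (measurable_subtype_coe hs), prior,
    integral_withDensity_eq_integral_toReal_smul hm (by simp), unitInterval.volume_def,
    inter_comm, ← setIntegral_indicator hs,
    ← integral_subtype_comap (measurableSet_Icc (a := (0 : ℝ)) (b := 1))]
  refine integral_congr_ae (ae_of_all _ fun θ => ?_)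
  by_cases h : (θ : ℝ) ∈ s
  · simp only [smul_eq_mul, ENNReal.toReal_ofReal (hp θ).le]
    rw [indicator_of_mem (by exact h), indicator_of_mem h, mul_comm]
  · simp only [smul_eq_mul]
    rw [indicator_of_notMem (by exact h), indicator_of_notMem h, mul_zero]

theorem isProbabilityMeasure_prior (hc : Continuous μ) (hp : ∀ x, 0 < μ x) (h1 : cdf μ 1 = 1) :
    IsProbabilityMeasure (prior μ) := by
  have hi : Integrable (fun θ : I => μ θ) volume := by
    have : Continuous fun θ : I => μ θ := hc.comp continuous_subtype_val
    exact this.integrable_of_hasCompactSupport (HasCompactSupport.of_compactSpace _)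
  have hfin : IsFiniteMeasure (prior μ) := isFiniteMeasure_withDensity_ofReal hi.2
  have h := setIntegral_prior hc hp (fun _ => 1) MeasurableSet.univ
  simp only [preimage_univ, Measure.restrict_univ, integral_const, smul_eq_mul, mul_one, one_mul,
    univ_inter, integral_Icc_eq_integral_Ioc] at h
  rw [← intervalIntegral.integral_of_le zero_le_one] at h
  rw [isProbabilityMeasure_iff_real, h]
  exact h1

theorem setIntegral_prior_tails (hc : Continuous μ) (hp : ∀ x, 0 < μ x) {f : ℝ → ℝ}
    (hf : Continuous f) {a b : ℝ} (ha : 0 ≤ a) (hab : a ≤ b) (hb : b ≤ 1) :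
    ∫ θ in {θ : I | a ≤ θ ∧ (θ : ℝ) ≤ b}ᶜ, f θ ∂prior μ =
      (∫ x in (0 : ℝ)..a, f x * μ x) + ∫ x in b..1, f x * μ x := by
  have e : {θ : I | a ≤ θ ∧ (θ : ℝ) ≤ b}ᶜ = ((↑) : I → ℝ) ⁻¹' (Icc a b)ᶜ := rfl
  have e' : (Icc a b)ᶜ ∩ Icc 0 1 = Ico 0 a ∪ Ioc b 1 := by
    ext x
    simp only [mem_inter_iff, mem_compl_iff, mem_Icc, mem_union, mem_Ico, mem_Ioc, not_and_or,
      not_le]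
    constructor
    · rintro ⟨h | h, h0, h1⟩
      exacts [Or.inl ⟨h0, h⟩, Or.inr ⟨h, h1⟩]
    · rintro (⟨h0, h⟩ | ⟨h, h1⟩)
      exacts [⟨Or.inl h, h0, by linarith⟩, ⟨Or.inr h, by linarith, h1⟩]
  have hcont : Continuous fun x => f x * μ x := hf.mul hc
  have hd : Disjoint (Ico 0 a) (Ioc b 1) :=
    Set.disjoint_left.2 fun x hx hx' => by linarith [hx.2, hx'.1]
  rw [e, setIntegral_prior hc hp f measurableSet_Icc.compl, e',
    setIntegral_union hd measurableSet_Ioc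
      (hcont.integrableOn_Icc.mono_set Ico_subset_Icc_self)
      (hcont.integrableOn_Icc.mono_set Ioc_subset_Icc_self),
    integral_Ico_eq_integral_Ioc, ← intervalIntegral.integral_of_le ha,
    ← intervalIntegral.integral_of_le hb]

theorem prior_real_tails (hc : Continuous μ) (hp : ∀ x, 0 < μ x) (h1 : cdf μ 1 = 1)
    {a b : ℝ} (ha : 0 ≤ a) (hab : a ≤ b) (hb : b ≤ 1) :
    (prior μ).real {θ : I | a ≤ θ ∧ (θ : ℝ) ≤ b}ᶜ = cdf μ a + 1 - cdf μ b := by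
  have h := setIntegral_prior_tails hc hp (f := fun _ => 1) continuous_const ha hab hb
  simp only [setIntegral_const, smul_eq_mul, mul_one, one_mul] at h
  have e : ∫ x in b..1, μ x = cdf μ 1 - cdf μ b :=
    (intervalIntegral.integral_interval_sub_left (hc.intervalIntegrable _ _)
      (hc.intervalIntegrable _ _)).symm
  rw [h, e, h1, ← add_sub_assoc]
  rfl

/-! ### Integration over random times -/

theorem integral_mul_intervalIntegral {Ω : Type*} [MeasurableSpace Ω] {P : Measure Ω}
    [IsFiniteMeasure P] {g τ : Ω → ℝ} (hg : Integrable g P) (hτ : Measurable τ)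
    (h0 : ∀ ω, 0 ≤ τ ω) {H : ℝ} (hH : ∀ ω, τ ω ≤ H) (hH0 : 0 ≤ H) {w : ℝ → ℝ}
    (hw : IntervalIntegrable w volume 0 H) :
    ∫ ω, g ω * (∫ t in (0 : ℝ)..τ ω, w t) ∂P =
      ∫ t in (0 : ℝ)..H, w t * ∫ ω in {ω | t < τ ω}, g ω ∂P := by
  have hwi : Integrable w (volume.restrict (Ioc 0 H)) :=
    (intervalIntegrable_iff_integrableOn_Ioc_of_le hH0).1 hw
  have hS : MeasurableSet {p : Ω × ℝ | p.2 < τ p.1} :=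
    measurableSet_lt measurable_snd (hτ.comp measurable_fst)
  have hint : Integrable (Function.uncurry fun ω t => (Iio (τ ω)).indicator (fun t => g ω * w t) t)
      (P.prod (volume.restrict (Ioc 0 H))) := by
    have := (hg.mul_prod hwi).indicator hS
    refine this.congr (ae_of_all _ fun p => ?_)
    simp only [Function.uncurry, indicator, mem_ofPred_eq, mem_Iio]
  have hswap := integral_integral_swap hint
  rw [intervalIntegral.integral_of_le hH0]
  calc _ = ∫ ω, (∫ t in Ioc 0 H, (Iio (τ ω)).indicator (fun t => g ω * w t) t) ∂P := by
        refine integral_congr_ae (ae_of_all _ fun ω => ?_)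
        beta_reduce
        have e : Ioc 0 H ∩ Iio (τ ω) = Ioo 0 (τ ω) := by
          ext t
          simp only [mem_Ioo, mem_inter_iff, mem_Ioc, mem_Iio]
          exact ⟨fun h => ⟨h.1.1, h.2⟩, fun h => ⟨⟨h.1, h.2.le.trans (hH ω)⟩, h.2⟩⟩
        rw [setIntegral_indicator measurableSet_Iio, integral_const_mul, e,
          intervalIntegral.integral_of_le (h0 ω), integral_Ioc_eq_integral_Ioo]
    _ = _ := hswap
    _ = _ := by
        refine integral_congr_ae (ae_of_all _ fun t => ?_)
        beta_reduce
        rw [← integral_const_mul, ← integral_indicator (measurableSet_lt measurable_const hτ)]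
        refine integral_congr_ae (ae_of_all _ fun ω => ?_)
        simp only [indicator, mem_ofPred_eq, mem_Iio, mul_comm]

/-! ### Optional stopping in continuous time -/

section OptionalStopping

variable {Ω : Type*} {mΩ : MeasurableSpace Ω} {P : Measure Ω} {ℱ : Filtration ℝ≥0 mΩ}
  {f : ℝ≥0 → Ω → ℝ} {τ : Ω → ℝ≥0}

/-- The smallest multiple of `1 / (n + 1)` that is strictly larger than `t`. -/
noncomputable def gridAbove (n : ℕ) (t : ℝ≥0) : ℝ≥0 := (⌊(n + 1) * t⌋₊ + 1) / (n + 1)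

theorem lt_gridAbove (n : ℕ) (t : ℝ≥0) : t < gridAbove n t := by
  rw [gridAbove, lt_div_iff₀ (by positivity), mul_comm]
  exact Nat.lt_floor_add_one _

theorem gridAbove_le (n : ℕ) (t : ℝ≥0) : gridAbove n t ≤ t + 1 / (n + 1) := by
  rw [gridAbove, add_div]
  gcongr
  rw [div_le_iff₀ (by positivity), mul_comm]
  exact Nat.floor_le (by positivity)

theorem tendsto_gridAbove (t : ℝ≥0) :
    Tendsto (fun n => gridAbove n t) atTop (𝓝[≥] t) := by
  refine tendsto_nhdsWithin_iff.2 ⟨?_, Eventually.of_forall fun n => (lt_gridAbove n t).le⟩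
  refine tendsto_of_tendsto_of_tendsto_of_le_of_le tendsto_const_nhds (h := fun n : ℕ =>
    t + 1 / ((n : ℝ≥0) + 1)) ?_ (fun n => (lt_gridAbove n t).le) fun n => gridAbove_le n t
  simpa using tendsto_const_nhds.add (tendsto_one_div_add_atTop_nhds_zero_nat (𝕜 := ℝ≥0))

theorem _root_.MeasureTheory.IsStoppingTime.measurable_nnreal
    (hτ : IsStoppingTime ℱ fun ω => (τ ω : WithTop ℝ≥0)) : Measurable τ := by
  refine measurable_of_Iic fun t => ℱ.le t _ ?_
  convert hτ t using 1
  ext ω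
  exact (WithTop.coe_le_coe (a := t) (b := τ ω)).symm

theorem measurable_stopped_gridAbove (hf : ∀ t, Measurable (f t)) (hτ : Measurable τ) (n : ℕ) :
    Measurable fun ω => f (gridAbove n (τ ω)) ω := by
  have h1 : Measurable fun p : ℕ × Ω => f (((p.1 : ℝ≥0) + 1) / (n + 1)) p.2 :=
    measurable_from_prod_countable_right fun k => by
      simpa only using hf (((k : ℝ≥0) + 1) / (n + 1))
  have h2 : Measurable fun ω => ⌊((n : ℝ≥0) + 1) * τ ω⌋₊ :=
    Nat.measurable_floor.comp (hτ.const_mul _)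
  have h3 : Measurable fun ω => (⌊((n : ℝ≥0) + 1) * τ ω⌋₊, ω) := h2.prodMk measurable_id
  simpa only [gridAbove, Function.comp_def] using h1.comp h3

theorem tendsto_stopped_gridAbove
    (hright : ∀ ω t, ContinuousWithinAt (fun s => f s ω) (Ici t) t) (ω : Ω) :
    Tendsto (fun n => f (gridAbove n (τ ω)) ω) atTop (𝓝 (f (τ ω) ω)) :=
  (hright ω (τ ω)).tendsto.comp (tendsto_gridAbove (τ ω))

theorem measurable_stopped (hf : ∀ t, Measurable (f t))
    (hright : ∀ ω t, ContinuousWithinAt (fun s => f s ω) (Ici t) t) (hτ : Measurable τ) :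
    Measurable fun ω => f (τ ω) ω :=
  measurable_of_tendsto_metrizable (fun n => measurable_stopped_gridAbove hf hτ n)
    (tendsto_pi_nhds.2 fun ω => tendsto_stopped_gridAbove hright ω)

/-- Optional stopping for a bounded right-continuous martingale at a bounded stopping time,
restricted to an event `A` known at time `s` on which stopping has not occurred before `s`. -/
theorem setIntegral_stopped [IsProbabilityMeasure P] (hf : Martingale f ℱ P)
    (hright : ∀ ω t, ContinuousWithinAt (fun s => f s ω) (Ici t) t) {C : ℝ}
    (hC : ∀ t ω, |f t ω| ≤ C) (hτ : IsStoppingTime ℱ fun ω => (τ ω : WithTop ℝ≥0)) {H : ℝ≥0}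
    (hH : ∀ ω, τ ω ≤ H) {s : ℝ≥0} {A : Set Ω} (hA : MeasurableSet[ℱ s] A)
    (hsA : ∀ ω ∈ A, s ≤ τ ω) :
    ∫ ω in A, f (τ ω) ω ∂P = ∫ ω in A, f s ω ∂P := by
  have hfm : ∀ t, Measurable (f t) := fun t =>
    ((hf.1 t).measurable).mono (ℱ.le t) le_rfl
  have hτm := hτ.measurable_nnreal
  have hAm : MeasurableSet A := ℱ.le s _ hA
  have key : ∀ n : ℕ, ∫ ω in A, f (gridAbove n (τ ω)) ω ∂P = ∫ ω in A, f s ω ∂P := by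
    intro n
    set k : Ω → ℕ := fun ω => ⌊((n : ℝ≥0) + 1) * τ ω⌋₊ with hk
    have hkm : Measurable k := by fun_prop
    set K : ℕ := ⌊((n : ℝ≥0) + 1) * H⌋₊ + 1 with hK
    have hkK : ∀ ω, k ω ∈ Finset.range K := fun ω => by
      rw [Finset.mem_range, hK, Nat.lt_succ_iff]
      exact Nat.floor_le_floor (by gcongr; exact hH ω)
    set B : ℕ → Set Ω := fun j => A ∩ k ⁻¹' {j} with hB
    have hBm : ∀ j, MeasurableSet (B j) := fun j => hAm.inter (hkm (measurableSet_singleton j))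
    have hunion : A = ⋃ j ∈ Finset.range K, B j := by
      ext ω
      simp only [hB, mem_iUnion, mem_inter_iff, mem_preimage, mem_singleton_iff, exists_prop]
      exact ⟨fun h => ⟨k ω, hkK ω, h, rfl⟩, fun ⟨j, _, h, _⟩ => h⟩
    have hdisj : Set.Pairwise (↑(Finset.range K)) (Function.onFun Disjoint B) := by
      intro i _ j _ hij
      refine Set.disjoint_left.2 fun ω h1 h2 => hij ?_
      exact h1.2.symm.trans h2.2
    -- All the grid times that matter are at most `H + 1`.
    have hint : ∀ g : Ω → ℝ, Measurable g → (∀ ω, |g ω| ≤ C) → Integrable g P := fun g hg hb =>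
      Integrable.of_bound hg.aestronglyMeasurable C (ae_of_all _ hb)
    have hgrid : ∫ ω in A, f (gridAbove n (τ ω)) ω ∂P = ∫ ω in A, f (max s (H + 1)) ω ∂P := by
      rw [hunion, integral_biUnion_finset _ (fun j _ => hBm j) hdisj
        (fun j _ => (hint _ (measurable_stopped_gridAbove hfm hτm n)
          fun ω => hC _ _).integrableOn),
        integral_biUnion_finset _ (fun j _ => hBm j) hdisj
        (fun j _ => (hint _ (hfm _) fun ω => hC _ _).integrableOn)]
      refine Finset.sum_congr rfl fun j hj => ?_
      set u : ℝ≥0 := (j + 1) / (n + 1) with hu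
      have hBu : ∀ ω ∈ B j, gridAbove n (τ ω) = u := fun ω hω => by
        have : k ω = j := hω.2
        rw [gridAbove, hu, ← this]
      have hstep : ∫ ω in B j, f (gridAbove n (τ ω)) ω ∂P = ∫ ω in B j, f u ω ∂P :=
        setIntegral_congr_fun (hBm j) fun ω hω => by simp only [hBu ω hω]
      rw [hstep]
      rcases lt_or_ge u s with hus | hus
      · have : B j = ∅ := by
          refine eq_empty_of_forall_notMem fun ω hω => ?_
          have h1 := hsA ω hω.1
          have h2 := lt_gridAbove n (τ ω)
          rw [hBu ω hω] at h2
          exact absurd (h1.trans_lt h2) hus.not_gt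
        simp [this]
      refine hf.setIntegral_eq (le_max_of_le_right ?_) ?_
      · have hjK : (j : ℝ≥0) ≤ (n + 1) * H := by
          have : j ≤ ⌊((n : ℝ≥0) + 1) * H⌋₊ := by
            rw [Finset.mem_range, hK, Nat.lt_succ_iff] at hj; exact hj
          exact (Nat.cast_le.2 this).trans (Nat.floor_le (by positivity))
        rw [hu, div_le_iff₀ (by positivity)]
        calc (j : ℝ≥0) + 1 ≤ (n + 1) * H + (n + 1) := by gcongr; simp
          _ = (H + 1) * (n + 1) := by ring
      · refine MeasurableSet.inter (ℱ.mono hus _ hA) ?_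
        have e : k ⁻¹' {j} = {ω | (τ ω : WithTop ℝ≥0) < ((j / (n + 1) : ℝ≥0) : WithTop ℝ≥0)}ᶜ ∩
            {ω | (τ ω : WithTop ℝ≥0) < (u : WithTop ℝ≥0)} := by
          ext ω
          simp only [hk, mem_preimage, mem_singleton_iff, mem_inter_iff, mem_compl_iff,
            mem_ofPred_eq, WithTop.coe_lt_coe, not_lt, hu]
          rw [Nat.floor_eq_iff (by positivity), div_le_iff₀ (by positivity),
            lt_div_iff₀ (by positivity), mul_comm]
        rw [e]
        refine MeasurableSet.inter (MeasurableSet.compl ?_) (hτ.measurableSet_lt u)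
        refine ℱ.mono ?_ _ (hτ.measurableSet_lt _)
        rw [hu]
        gcongr
        simp
    rw [hgrid]
    exact (hf.setIntegral_eq (le_max_left _ _) hA).symm
  have hlim : Tendsto (fun n => ∫ ω in A, f (gridAbove n (τ ω)) ω ∂P) atTop
      (𝓝 (∫ ω in A, f (τ ω) ω ∂P)) := by
    refine tendsto_integral_of_dominated_convergence (fun _ => C)
      (fun n => (measurable_stopped_gridAbove hfm hτm n).aestronglyMeasurable)
      (integrable_const C) (fun n => ae_of_all _ fun ω => hC _ _)
      (ae_of_all _ fun ω => tendsto_stopped_gridAbove hright ω)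
  simp only [key] at hlim
  exact tendsto_nhds_unique hlim tendsto_const_nhds

end OptionalStopping

/-! ### Necessary conditions for obedience -/

theorem mean_mem_Icc (ν : Measure I) [IsProbabilityMeasure ν] : mean ν ∈ Icc (0 : ℝ) 1 := by
  have hi : Integrable (fun θ : I => (θ : ℝ)) ν :=
    continuous_subtype_val.integrable_of_hasCompactSupport (HasCompactSupport.of_compactSpace _)
  refine ⟨integral_nonneg fun θ => θ.2.1, ?_⟩
  calc mean ν ≤ ∫ _, (1 : ℝ) ∂ν := integral_mono hi (integrable_const 1) fun θ => θ.2.2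
    _ = 1 := by simp

theorem agentU_mem_Icc {r m t : ℝ} (hr : 0 < r) (hm : m ≤ 1) (ht : 0 ≤ t) :
    agentU r m t ∈ Icc (0 : ℝ) 1 := by
  have h1 : Real.exp (-r * t) ≤ 1 := Real.exp_le_one_iff.2 (by nlinarith)
  have h2 : max m (1 / 2) ≤ 1 := max_le hm (by norm_num)
  have h3 : (0 : ℝ) ≤ max m (1 / 2) := le_max_of_le_right (by norm_num)
  exact ⟨mul_nonneg (Real.exp_pos _).le h3, mul_le_one₀ h1 h3 h2⟩

theorem measurable_agentU {Ω : Type*} [MeasurableSpace Ω] {r : ℝ} {m τ : Ω → ℝ}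
    (hm : Measurable m) (hτ : Measurable τ) : Measurable fun ω => agentU r (m ω) (τ ω) := by
  unfold agentU
  fun_prop

section Necessary

variable {Ω : Type*} {mΩ : MeasurableSpace Ω} {μ₀ : Measure I} {P : Measure Ω}
  {ℱ : Filtration ℝ≥0 mΩ} {X : ℝ≥0 → Ω → Measure I} {τ : Ω → ℝ≥0} {r : ℝ} {H : ℝ≥0}

namespace IsPersuasionStrategy

theorem abs_integral_le (hX : IsPersuasionStrategy μ₀ P ℱ X) (φ : C(I, ℝ)) (t : ℝ≥0) (ω : Ω) :
    |∫ θ, φ θ ∂(X t ω)| ≤ ‖φ‖ := by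
  have := hX.isBelief t ω
  have h := norm_integral_le_of_norm_le_const (μ := X t ω)
    (ae_of_all _ fun θ => φ.norm_coe_le_norm θ)
  simpa using h

theorem measurable_integral (hX : IsPersuasionStrategy μ₀ P ℱ X) (φ : C(I, ℝ)) (t : ℝ≥0) :
    Measurable fun ω => ∫ θ, φ θ ∂(X t ω) :=
  ((hX.martingale φ).1 t).measurable.mono (ℱ.le t) le_rfl

theorem measurable_integral_stopped (hX : IsPersuasionStrategy μ₀ P ℱ X) (φ : C(I, ℝ))
    (hτ : Measurable τ) : Measurable fun ω => ∫ θ, φ θ ∂(X (τ ω) ω) :=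
  measurable_stopped (f := fun t ω => ∫ θ, φ θ ∂(X t ω)) (hX.measurable_integral φ)
    (hX.rightContinuous φ) hτ

theorem measurable_mean_stopped (hX : IsPersuasionStrategy μ₀ P ℱ X) (hτ : Measurable τ) :
    Measurable fun ω => mean (X (τ ω) ω) :=
  hX.measurable_integral_stopped ⟨Subtype.val, continuous_subtype_val⟩ hτ

theorem mean_mem (hX : IsPersuasionStrategy μ₀ P ℱ X) (t : ℝ≥0) (ω : Ω) :
    mean (X t ω) ∈ Icc (0 : ℝ) 1 :=
  have := hX.isBelief t ω
  mean_mem_Icc _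

theorem integrable_mean_stopped (hX : IsPersuasionStrategy μ₀ P ℱ X) (hτ : Measurable τ) :
    Integrable (fun ω => mean (X (τ ω) ω)) P := by
  have := hX.isProbabilityMeasure
  refine Integrable.of_bound (hX.measurable_mean_stopped hτ).aestronglyMeasurable 1
    (ae_of_all _ fun ω => ?_)
  rw [Real.norm_of_nonneg (hX.mean_mem _ _).1]
  exact (hX.mean_mem _ _).2

theorem integrable_agentU_stopped (hX : IsPersuasionStrategy μ₀ P ℱ X) (hr : 0 < r)
    (hτ : Measurable τ) : Integrable (fun ω => agentU r (mean (X (τ ω) ω)) (τ ω)) P := by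
  have := hX.isProbabilityMeasure
  refine Integrable.of_bound (measurable_agentU (hX.measurable_mean_stopped hτ)
    hτ.coe_nnreal_real).aestronglyMeasurable 1 (ae_of_all _ fun ω => ?_)
  have h := agentU_mem_Icc hr (hX.mean_mem (τ ω) ω).2 (τ ω).2
  exact (Real.norm_of_nonneg h.1).trans_le h.2

theorem setIntegral_mean_stopped (hX : IsPersuasionStrategy μ₀ P ℱ X)
    (hτ : IsStoppingRule H ℱ τ) {s : ℝ≥0} {A : Set Ω} (hA : MeasurableSet[ℱ s] A)
    (hsA : ∀ ω ∈ A, s ≤ τ ω) :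
    ∫ ω in A, mean (X (τ ω) ω) ∂P = ∫ ω in A, mean (X s ω) ∂P :=
  have := hX.isProbabilityMeasure
  let φ : C(I, ℝ) := ⟨Subtype.val, continuous_subtype_val⟩
  setIntegral_stopped (hX.martingale φ) (hX.rightContinuous φ) (hX.abs_integral_le φ) hτ.1 hτ.2
    hA hsA

theorem integral_stopped (hX : IsPersuasionStrategy μ₀ P ℱ X) (hτ : IsStoppingRule H ℱ τ)
    (φ : C(I, ℝ)) : ∫ ω, ∫ θ, φ θ ∂(X (τ ω) ω) ∂P = ∫ θ, φ θ ∂μ₀ := by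
  have := hX.isProbabilityMeasure
  have h := setIntegral_stopped (hX.martingale φ) (hX.rightContinuous φ) (hX.abs_integral_le φ)
    hτ.1 hτ.2 (s := 0) MeasurableSet.univ fun ω _ => zero_le
  rw [setIntegral_univ, setIntegral_univ] at h
  exact h.trans (hX.bayesPlausible φ)

end IsPersuasionStrategy

theorem IsStoppingRule.measurable (hτ : IsStoppingRule H ℱ τ) : Measurable τ :=
  hτ.1.measurable_nnreal

/-- Stopping at once must not be profitable, whichever of the safe payoff `1/2` and the payoff
from the current mean the agent would then receive. -/
theorem IsObedient.initial_le (hX : IsPersuasionStrategy μ₀ P ℱ X) (hr : 0 < r)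
    (hτ : IsObedient r H P ℱ X τ) {p : ℝ} (hp0 : 0 ≤ p) (hp1 : p ≤ 1) :
    ∫ ω, (p * mean (X (τ ω) ω) + (1 - p) / 2) ∂P ≤ agentPayoff r P X τ := by
  have := hX.isProbabilityMeasure
  have h0 : IsStoppingRule H ℱ fun _ : Ω => (0 : ℝ≥0) :=
    ⟨isStoppingTime_const ℱ 0, fun _ => zero_le⟩
  refine le_trans ?_ (hτ.2 _ h0)
  have e := hX.setIntegral_mean_stopped hτ.1 (s := 0) MeasurableSet.univ fun ω _ => zero_le
  rw [setIntegral_univ, setIntegral_univ] at e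
  rw [integral_add ((hX.integrable_mean_stopped hτ.1.measurable).const_mul p) (integrable_const _),
    integral_const_mul, e, ← integral_const_mul, ← integral_add
      ((hX.integrable_mean_stopped measurable_const).const_mul p) (integrable_const _)]
  refine integral_mono (((hX.integrable_mean_stopped measurable_const).const_mul p).add
    (integrable_const _)) (hX.integrable_agentU_stopped hr measurable_const) fun ω => ?_
  simp only [agentU, NNReal.coe_zero, mul_zero, Real.exp_zero, one_mul]
  have h1 := le_max_left (mean (X 0 ω)) (1 / 2)
  have h2 := le_max_right (mean (X 0 ω)) (1 / 2)
  nlinarith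

/-- Abandoning the policy at time `t` must not be profitable on the event of no earlier stopping. -/
theorem IsObedient.continuation_le (hX : IsPersuasionStrategy μ₀ P ℱ X) (hr : 0 < r)
    (hτ : IsObedient r H P ℱ X τ) (t : ℝ≥0) :
    Real.exp (-r * t) * ∫ ω in {ω | t < τ ω}, mean (X (τ ω) ω) ∂P ≤
      ∫ ω in {ω | t < τ ω}, agentU r (mean (X (τ ω) ω)) (τ ω) ∂P := by
  have := hX.isProbabilityMeasure
  have hτm := hτ.1.measurable
  set A : Set Ω := {ω | t < τ ω} with hA
  have hAt : MeasurableSet[ℱ t] A := by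
    have h := (hτ.1.1 t).compl
    convert h using 1
    ext ω
    exact (WithTop.coe_lt_coe (a := τ ω) (b := t)).symm.trans not_le.symm
  have hAm : MeasurableSet A := ℱ.le t _ hAt
  set κ : Ω → ℝ≥0 := fun ω => min (τ ω) t with hκ
  have hκrule : IsStoppingRule H ℱ κ :=
    ⟨hτ.1.1.min_const t, fun ω => (min_le_left _ _).trans (hτ.1.2 ω)⟩
  have hle := hτ.2 κ hκrule
  have hκm := hκrule.measurable
  have iκ := hX.integrable_agentU_stopped hr hκm
  have iτ := hX.integrable_agentU_stopped hr hτm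
  have eκA : ∀ ω ∈ A, κ ω = t := fun ω hω => min_eq_right (le_of_lt hω)
  have eκC : ∀ ω ∈ Aᶜ, κ ω = τ ω := fun ω hω => min_eq_left (not_lt.1 hω)
  rw [agentPayoff, agentPayoff, ← integral_add_compl hAm iκ, ← integral_add_compl hAm iτ,
    setIntegral_congr_fun hAm.compl (g := fun ω => agentU r (mean (X (τ ω) ω)) (τ ω))
      (fun ω hω => by simp only [eκC ω hω])] at hle
  rw [hX.setIntegral_mean_stopped hτ.1 hAt fun ω hω => le_of_lt hω, ← integral_const_mul]
  refine le_trans ?_ (le_of_add_le_add_right hle)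
  refine setIntegral_mono_on
    ((hX.integrable_mean_stopped measurable_const).const_mul _).integrableOn iκ.integrableOn hAm
    fun ω hω => ?_
  simp only [eκA ω hω, agentU]
  exact mul_le_mul_of_nonneg_left (le_max_left _ _) (Real.exp_pos _).le

end Necessary

/-! ### The Lagrangian -/

/-- The Lagrangian of the principal's relaxed problem: `weight` is the density of the multiplier on
the constraints that continuing at time `t` is worth at least the current mean, and `mass` is the
multiplier on the constraint that the policy is worth at least `p * mean + (1 - p) / 2` at time
`0`. -/
noncomputable def lagrangian (r θlow p mass : ℝ) (weight : ℝ → ℝ) (m t : ℝ) : ℝ :=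
  principalV θlow m t + mass * (agentU r m t - (p * m + (1 - p) / 2)) +
    (agentU r m t * (∫ s in (0 : ℝ)..t, weight s) -
      m * ∫ s in (0 : ℝ)..t, weight s * Real.exp (-r * s))

theorem intervalIntegrable_mul_exp {w : ℝ → ℝ} {a b : ℝ} (hw : IntervalIntegrable w volume a b)
    (r : ℝ) : IntervalIntegrable (fun s => w s * Real.exp (-r * s)) volume a b :=
  hw.mul_continuousOn (by fun_prop)

theorem continuousOn_primitive_Icc {H : ℝ} {w : ℝ → ℝ} (hH0 : 0 ≤ H)
    (hw : IntervalIntegrable w volume 0 H) :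
    ContinuousOn (fun t => ∫ s in (0 : ℝ)..t, w s) (Icc 0 H) := by
  have hwI : IntegrableOn w (uIcc 0 H) volume := by
    rwa [uIcc_of_le hH0, integrableOn_Icc_iff_integrableOn_Ioc,
      ← intervalIntegrable_iff_integrableOn_Ioc_of_le hH0]
  simpa only [uIcc_of_le hH0] using intervalIntegral.continuousOn_primitive_interval hwI

/-- The expected Lagrangian is the principal's payoff plus the weighted slacks. -/
theorem integral_lagrangian {Ω : Type*} [MeasurableSpace Ω] {P : Measure Ω}
    [IsProbabilityMeasure P] {r θlow p mass H : ℝ} {w : ℝ → ℝ} (hr : 0 < r) (hH0 : 0 ≤ H)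
    (hw : IntervalIntegrable w volume 0 H) {m τ : Ω → ℝ} (hm : Measurable m)
    (hmI : ∀ ω, m ω ∈ Icc (0 : ℝ) 1) (hτ : Measurable τ) (hτI : ∀ ω, τ ω ∈ Icc 0 H) :
    Integrable (fun ω => lagrangian r θlow p mass w (m ω) (τ ω)) P ∧
    ∫ ω, lagrangian r θlow p mass w (m ω) (τ ω) ∂P =
      ∫ ω, principalV θlow (m ω) (τ ω) ∂P +
      mass * (∫ ω, agentU r (m ω) (τ ω) ∂P - ∫ ω, (p * m ω + (1 - p) / 2) ∂P) +
      ∫ t in (0 : ℝ)..H, w t * (∫ ω in {ω | t < τ ω}, agentU r (m ω) (τ ω) ∂P -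
        Real.exp (-r * t) * ∫ ω in {ω | t < τ ω}, m ω ∂P) := by
  have hwi := hw
  have hwe := intervalIntegrable_mul_exp hw r
  have im : Integrable m P := Integrable.of_bound hm.aestronglyMeasurable 1
    (ae_of_all _ fun ω => (Real.norm_of_nonneg (hmI ω).1).trans_le (hmI ω).2)
  have iU : Integrable (fun ω => agentU r (m ω) (τ ω)) P := by
    refine Integrable.of_bound (measurable_agentU hm hτ).aestronglyMeasurable 1
      (ae_of_all _ fun ω => ?_)
    have h := agentU_mem_Icc hr (hmI ω).2 (hτI ω).1
    exact (Real.norm_of_nonneg h.1).trans_le h.2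
  have iV : Integrable (fun ω => principalV θlow (m ω) (τ ω)) P := by
    refine Integrable.of_bound (C := (1 + |θlow|) * H)
      ((hm.sub_const θlow).mul hτ).aestronglyMeasurable (ae_of_all _ fun ω => ?_)
    rw [principalV, norm_mul, Real.norm_eq_abs, Real.norm_of_nonneg (hτI ω).1]
    refine mul_le_mul ((abs_sub _ _).trans ?_) (hτI ω).2 (hτI ω).1 (by positivity)
    rw [abs_of_nonneg (hmI ω).1]
    linarith [(hmI ω).2]
  -- A primitive composed with `τ` is measurable and bounded.
  have prim : ∀ v : ℝ → ℝ, IntervalIntegrable v volume 0 H → ∀ g : Ω → ℝ, Integrable g P →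
      Integrable (fun ω => g ω * ∫ s in (0 : ℝ)..τ ω, v s) P := by
    intro v hv g hg
    have hcont := continuousOn_primitive_Icc hH0 hv
    obtain ⟨C, hC⟩ := isCompact_Icc.exists_bound_of_continuousOn hcont
    have hmeas : Measurable fun ω => ∫ s in (0 : ℝ)..τ ω, v s := by
      have h1 : Measurable fun x : Icc 0 H => ∫ s in (0 : ℝ)..(x : ℝ), v s :=
        (continuousOn_iff_continuous_domRestrict.1 hcont).measurable
      exact h1.comp (hτ.subtype_mk (h := hτI))
    exact hg.mul_bdd (c := C) hmeas.aestronglyMeasurable (ae_of_all _ fun ω => hC _ (hτI ω))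
  have i1 := prim w hwi _ iU
  have i2 := prim _ hwe _ im
  have ik : Integrable (fun ω => p * m ω + (1 - p) / 2) P :=
    (im.const_mul p).add (integrable_const _)
  have iUk : Integrable (fun ω => mass * (agentU r (m ω) (τ ω) - (p * m ω + (1 - p) / 2))) P :=
    (iU.sub ik).const_mul mass
  have i12 : Integrable (fun ω => agentU r (m ω) (τ ω) * (∫ s in (0 : ℝ)..τ ω, w s) -
      m ω * ∫ s in (0 : ℝ)..τ ω, w s * Real.exp (-r * s)) P := i1.sub i2
  have iVUk : Integrable (fun ω => principalV θlow (m ω) (τ ω) +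
      mass * (agentU r (m ω) (τ ω) - (p * m ω + (1 - p) / 2))) P := iV.add iUk
  refine ⟨iVUk.add i12, ?_⟩
  simp only [lagrangian]
  rw [integral_add iVUk i12, integral_add iV iUk, integral_const_mul,
    integral_sub iU ik, integral_sub i1 i2,
    integral_mul_intervalIntegral iU hτ (fun ω => (hτI ω).1) (fun ω => (hτI ω).2) hH0 hwi,
    integral_mul_intervalIntegral im hτ (fun ω => (hτI ω).1) (fun ω => (hτI ω).2) hH0 hwe]
  congr 1
  have hbd : ∀ g : Ω → ℝ, Measurable g → (∀ ω, g ω ∈ Icc (0 : ℝ) 1) →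
      ∀ v : ℝ → ℝ, IntervalIntegrable v volume 0 H →
      IntervalIntegrable (fun t => v t * ∫ ω in {ω | t < τ ω}, g ω ∂P) volume 0 H := by
    intro g hg hgI v hv
    have ig : Integrable g P := Integrable.of_bound hg.aestronglyMeasurable 1
      (ae_of_all _ fun ω => (Real.norm_of_nonneg (hgI ω).1).trans_le (hgI ω).2)
    have hanti : Antitone fun t : ℝ => ∫ ω in {ω | t < τ ω}, g ω ∂P := fun s t hst =>
      setIntegral_mono_set ig.integrableOn (ae_of_all _ fun ω => (hgI ω).1)
        (ae_of_all _ fun ω (hω : t < τ ω) => lt_of_le_of_lt hst hω)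
    refine (intervalIntegrable_iff.1 hv).mul_bdd (c := 1) hanti.measurable.aestronglyMeasurable
      (ae_of_all _ fun t => ?_) |> intervalIntegrable_iff.2
    rw [Real.norm_of_nonneg (setIntegral_nonneg (measurableSet_lt measurable_const hτ)
      fun ω _ => (hgI ω).1)]
    calc ∫ ω in {ω | t < τ ω}, g ω ∂P ≤ ∫ ω, g ω ∂P :=
          setIntegral_le_integral ig (ae_of_all _ fun ω => (hgI ω).1)
      _ ≤ ∫ _, (1 : ℝ) ∂P := integral_mono ig (integrable_const _) fun ω => (hgI ω).2
      _ = 1 := by simp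
  rw [← intervalIntegral.integral_sub
    (hbd _ (measurable_agentU hm hτ) (fun ω => agentU_mem_Icc hr (hmI ω).2 (hτI ω).1) _ hwi)
    (hbd _ hm hmI _ hwe)]
  congr 1
  ext t
  ring

/-! ### Tail-censorship is a persuasion strategy -/

/-- Beliefs on `[0,1]` whose means tend to `1` converge weakly to the point mass at `1`. -/
theorem tendsto_integral_of_tendsto_mean_one {ι : Type*} {l : Filter ι} {ν : ι → Measure I}
    (hν : ∀ᶠ i in l, IsProbabilityMeasure (ν i)) (hmean : Tendsto (fun i => mean (ν i)) l (𝓝 1))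
    (φ : C(I, ℝ)) : Tendsto (fun i => ∫ θ, φ θ ∂(ν i)) l (𝓝 (φ 1)) := by
  rw [Metric.tendsto_nhds]
  intro ε hε
  obtain ⟨δ, hδ, hδφ⟩ := Metric.continuousAt_iff.1 (φ.continuous.continuousAt (x := (1 : I)))
    (ε / 2) (by positivity)
  set K := 2 * ‖φ‖ / δ with hK
  have hK0 : 0 ≤ K := by positivity
  have hpt : ∀ θ : I, |φ θ - φ 1| ≤ ε / 2 + K * (1 - θ) := by
    intro θ
    have hθ : (0 : ℝ) ≤ 1 - θ := by linarith [θ.2.2]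
    by_cases h : dist θ 1 < δ
    · have := hδφ h
      rw [Real.dist_eq] at this
      nlinarith
    · have hd : dist θ 1 = 1 - θ := by
        rw [Subtype.dist_eq, Real.dist_eq, abs_sub_comm]
        exact abs_of_nonneg hθ
      rw [hd, not_lt] at h
      have h2 : |φ θ - φ 1| ≤ 2 * ‖φ‖ := by
        have h3 := abs_sub (φ θ) (φ 1)
        have h4 := φ.norm_coe_le_norm θ
        have h5 := φ.norm_coe_le_norm 1
        rw [Real.norm_eq_abs] at h4 h5
        linarith
      have h6 : 2 * ‖φ‖ = K * δ := by rw [hK]; field_simp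
      nlinarith
  have hev : ∀ᶠ i in l, K * (1 - mean (ν i)) < ε / 2 := by
    have : Tendsto (fun i => K * (1 - mean (ν i))) l (𝓝 (K * (1 - 1))) :=
      (hmean.const_sub 1).const_mul K
    rw [sub_self, mul_zero] at this
    exact this.eventually_lt_const (by positivity)
  filter_upwards [hν, hev] with i hi hlt
  have iφ : Integrable (fun θ => φ θ) (ν i) :=
    φ.continuous.integrable_of_hasCompactSupport (HasCompactSupport.of_compactSpace _)
  have iid : Integrable (fun θ : I => (θ : ℝ)) (ν i) :=
    continuous_subtype_val.integrable_of_hasCompactSupport (HasCompactSupport.of_compactSpace _)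
  have ilin : Integrable (fun θ : I => K * (1 - (θ : ℝ))) (ν i) :=
    ((integrable_const _).sub iid).const_mul K
  have hconst : ∫ _, φ 1 ∂(ν i) = φ 1 := by simp
  rw [Real.dist_eq]
  calc |∫ θ, φ θ ∂(ν i) - φ 1| = |∫ θ, (φ θ - φ 1) ∂(ν i)| := by
        rw [integral_sub iφ (integrable_const _), hconst]
    _ ≤ ∫ θ, |φ θ - φ 1| ∂(ν i) := abs_integral_le_integral_abs
    _ ≤ ∫ θ : I, (ε / 2 + K * (1 - θ)) ∂(ν i) :=
        integral_mono (iφ.sub (integrable_const _)).abs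
          ((integrable_const _).add ilin) hpt
    _ = ε / 2 + K * (1 - mean (ν i)) := by
        rw [integral_add (integrable_const _) ilin,
          integral_const_mul, integral_sub (integrable_const _) iid]
        simp [mean]
    _ < ε := by linarith

section Interval

variable {α β : ℝ → ℝ} {T : ℝ} {μ₀ : Measure I}

theorem min_mem_Icc (hT : 0 ≤ T) (t : ℝ≥0) : min (t : ℝ) T ∈ Icc 0 T :=
  ⟨le_min t.2 hT, min_le_right _ _⟩

theorem IsExpandingInterval.continuous_lower (h : IsExpandingInterval α β T) (hT : 0 ≤ T) :
    Continuous fun t : ℝ≥0 => α (min (t : ℝ) T) :=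
  h.continuousOn_lower.comp_continuous (by fun_prop) (min_mem_Icc hT)

theorem IsExpandingInterval.continuous_upper (h : IsExpandingInterval α β T) (hT : 0 ≤ T) :
    Continuous fun t : ℝ≥0 => β (min (t : ℝ) T) :=
  h.continuousOn_upper.comp_continuous (by fun_prop) (min_mem_Icc hT)

theorem IsExpandingInterval.revealed_mono (h : IsExpandingInterval α β T) (hT : 0 ≤ T) :
    Monotone (revealed α β T) := fun s t hst _ hθ =>
  have hle : min (s : ℝ) T ≤ min (t : ℝ) T := min_le_min_right _ (NNReal.coe_le_coe.2 hst)
  ⟨(h.antitoneOn_lower (min_mem_Icc hT s) (min_mem_Icc hT t) hle).trans hθ.1,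
    hθ.2.trans (h.monotoneOn_upper (min_mem_Icc hT s) (min_mem_Icc hT t) hle)⟩

theorem IsExpandingInterval.isClosed_revealed (h : IsExpandingInterval α β T) (hT : 0 ≤ T)
    (θ : I) : IsClosed {t : ℝ≥0 | θ ∈ revealed α β T t} :=
  (isClosed_le (h.continuous_lower hT) continuous_const).inter
    (isClosed_le continuous_const (h.continuous_upper hT))

theorem tailBelief_of_mem {t : ℝ≥0} {θ : I} (h : θ ∈ revealed α β T t) :
    tailBelief μ₀ α β T t θ = Measure.dirac θ := if_pos h

theorem tailBelief_of_notMem {t : ℝ≥0} {θ : I} (h : θ ∉ revealed α β T t) :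
    tailBelief μ₀ α β T t θ = cond μ₀ (revealed α β T t)ᶜ := if_neg h

theorem integral_tailBelief_of_notMem {φ : I → ℝ} {t : ℝ≥0} {θ : I}
    (hθ : θ ∉ revealed α β T t) : ∫ x, φ x ∂(tailBelief μ₀ α β T t θ) =
      (μ₀.real (revealed α β T t)ᶜ)⁻¹ * ∫ x in (revealed α β T t)ᶜ, φ x ∂μ₀ := by
  rw [tailBelief_of_notMem hθ, ProbabilityTheory.cond, integral_smul_measure, ENNReal.toReal_inv,
    smul_eq_mul, measureReal_def]

theorem mean_tailBelief_of_mem {t : ℝ≥0} {θ : I}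
    (hθ : θ ∈ revealed α β T t) : mean (tailBelief μ₀ α β T t θ) = θ := by
  rw [tailBelief_of_mem hθ, mean]
  exact integral_dirac' _ _ continuous_subtype_val.stronglyMeasurable

/-- The agent cannot tell apart two states that are both still censored. -/
theorem IsExpandingInterval.subset_or_subset_compl (h : IsExpandingInterval α β T) (hT : 0 ≤ T)
    {t : ℝ≥0} {A : Set I} (hA : MeasurableSet[tailFiltration μ₀ α β T t] A) :
    (revealed α β T t)ᶜ ⊆ A ∨ (revealed α β T t)ᶜ ⊆ Aᶜ := by
  set N := (revealed α β T t)ᶜ with hN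
  let m : MeasurableSpace I :=
    { MeasurableSet' := fun A => N ⊆ A ∨ N ⊆ Aᶜ
      measurableSet_empty := Or.inr (by simp)
      measurableSet_compl := fun A hA => by rwa [compl_compl, or_comm]
      measurableSet_iUnion := fun A hA => by
        by_cases hex : ∃ i, N ⊆ A i
        · obtain ⟨i, hi⟩ := hex
          exact Or.inl (hi.trans (subset_iUnion A i))
        · push Not at hex
          refine Or.inr ?_
          rw [compl_iUnion]
          exact subset_iInter fun i => (hA i).resolve_left (hex i) }
  have hle : tailFiltration μ₀ α β T t ≤ m := by
    refine iSup_le fun s => ?_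
    rintro _ ⟨B, -, rfl⟩
    have hconst : ∀ θ ∈ N, tailBelief μ₀ α β T s θ = cond μ₀ (revealed α β T s)ᶜ := fun θ hθ =>
      tailBelief_of_notMem fun hmem => hθ (h.revealed_mono hT s.2 hmem)
    by_cases hB : cond μ₀ (revealed α β T s)ᶜ ∈ B
    · exact Or.inl fun θ hθ => by rwa [mem_preimage, hconst θ hθ]
    · exact Or.inr fun θ hθ => by rwa [mem_compl_iff, mem_preimage, hconst θ hθ]
  exact hle A hA

theorem measurableSet_revealed_tailFiltration [IsFiniteMeasure μ₀] (t : ℝ≥0) :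
    MeasurableSet[tailFiltration μ₀ α β T t] (revealed α β T t) := by
  have hle : MeasurableSpace.comap (tailBelief μ₀ α β T t) inferInstance ≤
      tailFiltration μ₀ α β T t := le_iSup (fun s : Iic t =>
        MeasurableSpace.comap (tailBelief μ₀ α β T s) inferInstance) ⟨t, self_mem_Iic⟩
  refine hle _ ⟨{ν | ν (revealed α β T t) = 1},
    Measure.measurable_coe (measurableSet_revealed α β T t) (measurableSet_singleton 1), ?_⟩
  ext θ
  by_cases hθ : θ ∈ revealed α β T t
  · simp only [mem_preimage, mem_ofPred_eq, tailBelief_of_mem hθ, hθ, iff_true]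
    rw [Measure.dirac_apply' _ (measurableSet_revealed α β T t), indicator_of_mem hθ]
    rfl
  · simp only [mem_preimage, mem_ofPred_eq, tailBelief_of_notMem hθ, hθ, iff_false]
    rw [cond_apply (measurableSet_revealed α β T t).compl, compl_inter_self, measure_empty,
      mul_zero]
    exact zero_ne_one

theorem stronglyMeasurable_integral_tailBelief (hprob : ∀ t θ,
    IsProbabilityMeasure (tailBelief μ₀ α β T t θ)) (φ : C(I, ℝ)) (t : ℝ≥0) :
    StronglyMeasurable[tailFiltration μ₀ α β T t]
      fun θ => ∫ x, φ x ∂(tailBelief μ₀ α β T t θ) := by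
  have hle : MeasurableSpace.comap (tailBelief μ₀ α β T t) inferInstance ≤
      tailFiltration μ₀ α β T t := le_iSup (fun s : Iic t =>
        MeasurableSpace.comap (tailBelief μ₀ α β T s) inferInstance) ⟨t, self_mem_Iic⟩
  have e : (fun θ => ∫ x, φ x ∂(tailBelief μ₀ α β T t θ)) = (fun ν : Measure I =>
      (∫⁻ x, ENNReal.ofReal (φ x) ∂ν).toReal - (∫⁻ x, ENNReal.ofReal (-φ x) ∂ν).toReal) ∘
      tailBelief μ₀ α β T t := by
    funext θ
    have := hprob t θ
    exact integral_eq_lintegral_pos_part_sub_lintegral_neg_part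
      (φ.continuous.integrable_of_hasCompactSupport (HasCompactSupport.of_compactSpace _))
  rw [e]
  refine Measurable.stronglyMeasurable ?_
  refine Measurable.comp ?_ ((comap_measurable _).mono hle le_rfl)
  have hφ := φ.continuous.measurable
  exact (Measure.measurable_lintegral hφ.ennreal_ofReal).ennreal_toReal.sub
    (Measure.measurable_lintegral hφ.neg.ennreal_ofReal).ennreal_toReal

/-- On every event that contains the censored states, the conditional expectation of `φ` given the
belief integrates to the same value as `φ`. -/
theorem setIntegral_tailBelief [IsFiniteMeasure μ₀]
    (hprob : ∀ t θ, IsProbabilityMeasure (tailBelief μ₀ α β T t θ)) (φ : C(I, ℝ)) {t : ℝ≥0}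
    {A : Set I} (hA : MeasurableSet A) (hNA : (revealed α β T t)ᶜ ⊆ A) :
    ∫ θ in A, (∫ x, φ x ∂(tailBelief μ₀ α β T t θ)) ∂μ₀ = ∫ θ in A, φ θ ∂μ₀ := by
  set R := revealed α β T t with hR
  have hRm : MeasurableSet R := measurableSet_revealed α β T t
  have iφ : Integrable (fun θ => φ θ) μ₀ :=
    φ.continuous.integrable_of_hasCompactSupport (HasCompactSupport.of_compactSpace _)
  have iB : Integrable (fun θ => ∫ x, φ x ∂(tailBelief μ₀ α β T t θ)) μ₀ := by
    refine Integrable.of_bound ((stronglyMeasurable_integral_tailBelief hprob φ t).mono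
      ((tailFiltration μ₀ α β T).le t)).aestronglyMeasurable ‖φ‖ (ae_of_all _ fun θ => ?_)
    have := hprob t θ
    simpa using norm_integral_le_of_norm_le_const (μ := tailBelief μ₀ α β T t θ)
      (ae_of_all _ fun x => φ.norm_coe_le_norm x)
  rw [← integral_inter_add_sdiff hRm iB.integrableOn,
    ← integral_inter_add_sdiff hRm iφ.integrableOn]
  have eN : A \ R = Rᶜ := by
    rw [sdiff_eq]; exact inter_eq_self_of_subset_right hNA
  rw [eN]
  congr 1
  · refine setIntegral_congr_fun (hA.inter hRm) fun θ hθ => ?_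
    simp only [tailBelief_of_mem hθ.2]
    exact integral_dirac' _ _ φ.continuous.stronglyMeasurable
  · rw [setIntegral_congr_fun hRm.compl (g := fun _ => ∫ x, φ x ∂(cond μ₀ Rᶜ))
      fun θ hθ => by simp only [tailBelief_of_notMem hθ, hR], setIntegral_const,
      ProbabilityTheory.cond, integral_smul_measure, ENNReal.toReal_inv, smul_eq_mul,
      smul_eq_mul, measureReal_def]
    rcases eq_or_ne (μ₀ Rᶜ) 0 with h0 | h0
    · rw [Measure.restrict_eq_zero.2 h0]; simp
    · rw [mul_inv_cancel_left₀]
      exact ENNReal.toReal_ne_zero.2 ⟨h0, measure_ne_top _ _⟩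

theorem IsExpandingInterval.martingale_tailBelief [IsFiniteMeasure μ₀]
    (h : IsExpandingInterval α β T) (hT : 0 ≤ T)
    (hprob : ∀ t θ, IsProbabilityMeasure (tailBelief μ₀ α β T t θ)) (φ : C(I, ℝ)) :
    Martingale (fun t θ => ∫ x, φ x ∂(tailBelief μ₀ α β T t θ)) (tailFiltration μ₀ α β T) μ₀ := by
  have hsm := stronglyMeasurable_integral_tailBelief (μ₀ := μ₀) hprob φ
  have hint : ∀ t, Integrable (fun θ => ∫ x, φ x ∂(tailBelief μ₀ α β T t θ)) μ₀ := fun t => by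
    refine Integrable.of_bound ((hsm t).mono
      ((tailFiltration μ₀ α β T).le t)).aestronglyMeasurable ‖φ‖ (ae_of_all _ fun θ => ?_)
    have := hprob t θ
    simpa using norm_integral_le_of_norm_le_const (μ := tailBelief μ₀ α β T t θ)
      (ae_of_all _ fun x => φ.norm_coe_le_norm x)
  refine ⟨hsm, fun s t hst => ?_⟩
  symm
  refine ae_eq_condExp_of_forall_setIntegral_eq ((tailFiltration μ₀ α β T).le s) (hint t)
    (fun A _ _ => (hint s).integrableOn) (fun A hA _ => ?_) (hsm s).aestronglyMeasurable
  have hAm : MeasurableSet A := (tailFiltration μ₀ α β T).le s _ hA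
  have hmono := h.revealed_mono hT hst
  rcases h.subset_or_subset_compl hT hA with hN | hN
  · rw [setIntegral_tailBelief hprob φ hAm hN,
      setIntegral_tailBelief hprob φ hAm ((compl_subset_compl.2 hmono).trans hN)]
  · have hAR : A ⊆ revealed α β T s := compl_subset_compl.1 hN
    refine setIntegral_congr_fun hAm fun θ hθ => ?_
    simp only [tailBelief_of_mem (hAR hθ), tailBelief_of_mem (hmono (hAR hθ))]

end Interval

namespace IsSilenceCurve

variable {r : ℝ} {α β : ℝ → ℝ} {T : ℝ}

theorem setIntegral_silent (hS : IsSilenceCurve μ r α β T) (hc : Continuous μ)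
    (hp : ∀ x, 0 < μ x) {f : ℝ → ℝ} (hf : Continuous f) (t : ℝ≥0) :
    ∫ θ in (revealed α β T t)ᶜ, f θ ∂prior μ =
      (∫ x in (0 : ℝ)..α (min (t : ℝ) T), f x * μ x) + ∫ x in β (min (t : ℝ) T)..1, f x * μ x :=
  have h := hS.expanding.ordered _ (min_mem_Icc hS.pos.le t)
  setIntegral_prior_tails hc hp hf h.1 h.2.1 h.2.2

theorem continuous_setIntegral_silent (hS : IsSilenceCurve μ r α β T) (hc : Continuous μ)
    (hp : ∀ x, 0 < μ x) {f : ℝ → ℝ} (hf : Continuous f) :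
    Continuous fun t => ∫ θ in (revealed α β T t)ᶜ, f θ ∂prior μ := by
  simp only [hS.setIntegral_silent hc hp hf]
  have hi : ∀ a b, IntervalIntegrable (fun x => f x * μ x) volume a b :=
    fun a b => (hf.mul hc).intervalIntegrable a b
  have h1 : Continuous fun b => ∫ x in (0 : ℝ)..b, f x * μ x :=
    intervalIntegral.continuous_primitive hi 0
  have h2 : Continuous fun b => ∫ x in b..(1 : ℝ), f x * μ x := by
    simp only [intervalIntegral.integral_symm 1]
    exact (intervalIntegral.continuous_primitive hi 1).neg
  exact (h1.comp (hS.expanding.continuous_lower hS.pos.le)).add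
    (h2.comp (hS.expanding.continuous_upper hS.pos.le))

theorem silent_real (hS : IsSilenceCurve μ r α β T) (hc : Continuous μ)
    (hp : ∀ x, 0 < μ x) (h1 : cdf μ 1 = 1) (t : ℝ≥0) :
    (prior μ).real (revealed α β T t)ᶜ =
      cdf μ (α (min (t : ℝ) T)) + 1 - cdf μ (β (min (t : ℝ) T)) :=
  have h := hS.expanding.ordered _ (min_mem_Icc hS.pos.le t)
  prior_real_tails hc hp h1 h.1 h.2.1 h.2.2

theorem silent_real_pos (hS : IsSilenceCurve μ r α β T) (hc : Continuous μ)
    (hp : ∀ x, 0 < μ x) (h1 : cdf μ 1 = 1) {t : ℝ≥0} {θ : I} (hθ : θ ∉ revealed α β T t) :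
    0 < (prior μ).real (revealed α β T t)ᶜ := by
  have h := hS.expanding.ordered _ (min_mem_Icc hS.pos.le t)
  have hm := cdf_strictMono hc hp
  rw [hS.silent_real hc hp h1]
  have hα : 0 ≤ cdf μ (α (min (t : ℝ) T)) := by
    have := hm.monotone h.1
    rwa [cdf_zero] at this
  have hβ : cdf μ (β (min (t : ℝ) T)) ≤ 1 := h1 ▸ hm.monotone h.2.2
  by_cases hlow : α (min (t : ℝ) T) ≤ θ
  · have hup : β (min (t : ℝ) T) < θ := by
      by_contra! hle
      exact hθ ⟨hlow, hle⟩
    have := hm (hup.trans_le θ.2.2)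
    rw [h1] at this
    linarith
  · have := hm (θ.2.1.trans_lt (not_le.1 hlow))
    rw [cdf_zero] at this
    linarith

theorem setIntegral_silent_id (hS : IsSilenceCurve μ r α β T) (hc : Continuous μ)
    (hp : ∀ x, 0 < μ x) (h1 : cdf μ 1 = 1) (t : ℝ≥0) :
    ∫ θ in (revealed α β T t)ᶜ, (θ : ℝ) ∂prior μ =
      β (min (t : ℝ) T) * (prior μ).real (revealed α β T t)ᶜ := by
  have h := hS.tailExcess_eq_zero _ (min_mem_Icc hS.pos.le t)
  have := isProbabilityMeasure_prior hc hp h1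
  have e := hS.setIntegral_silent hc hp (f := fun x => x - β (min (t : ℝ) T)) (by fun_prop) t
  rw [tailExcess] at h
  rw [h, integral_sub, setIntegral_const, smul_eq_mul] at e
  · linarith
  · exact (continuous_subtype_val.integrable_of_hasCompactSupport
      (HasCompactSupport.of_compactSpace _)).integrableOn
  · exact integrable_const _

theorem isProbabilityMeasure_tailBelief (hS : IsSilenceCurve μ r α β T) (hc : Continuous μ)
    (hp : ∀ x, 0 < μ x) (h1 : cdf μ 1 = 1) (t : ℝ≥0) (θ : I) :
    IsProbabilityMeasure (tailBelief (prior μ) α β T t θ) := by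
  have := isProbabilityMeasure_prior hc hp h1
  by_cases hθ : θ ∈ revealed α β T t
  · rw [tailBelief_of_mem hθ]
    infer_instance
  · rw [tailBelief_of_notMem hθ]
    refine cond_isProbabilityMeasure fun h0 => ?_
    have := hS.silent_real_pos hc hp h1 hθ
    rw [measureReal_def, h0] at this
    exact this.ne' rfl

theorem mean_tailBelief_of_notMem (hS : IsSilenceCurve μ r α β T) (hc : Continuous μ)
    (hp : ∀ x, 0 < μ x) (h1 : cdf μ 1 = 1) {t : ℝ≥0} {θ : I} (hθ : θ ∉ revealed α β T t) :
    mean (tailBelief (prior μ) α β T t θ) = β (min (t : ℝ) T) := by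
  have hpos := hS.silent_real_pos hc hp h1 hθ
  rw [mean, integral_tailBelief_of_notMem hθ, hS.setIntegral_silent_id hc hp h1]
  field_simp

theorem isPersuasionStrategy (hS : IsSilenceCurve μ r α β T) (hc : Continuous μ)
    (hp : ∀ x, 0 < μ x) (h1 : cdf μ 1 = 1) :
    IsPersuasionStrategy (prior μ) (prior μ) (tailFiltration (prior μ) α β T)
      (tailBelief (prior μ) α β T) := by
  have hprior := isProbabilityMeasure_prior hc hp h1
  have hprob := hS.isProbabilityMeasure_tailBelief hc hp h1
  have hmono := hS.expanding.revealed_mono hS.pos.le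
  have hclosed := hS.expanding.isClosed_revealed hS.pos.le
  -- The belief after silence moves continuously as long as silence has positive probability.
  have hcont : ∀ (φ : C(I, ℝ)) (t : ℝ≥0), 0 < (prior μ).real (revealed α β T t)ᶜ →
      ContinuousAt (fun s => ((prior μ).real (revealed α β T s)ᶜ)⁻¹ *
        ∫ x in (revealed α β T s)ᶜ, φ x ∂prior μ) t := by
    intro φ t ht
    have c1 : Continuous fun s => (prior μ).real (revealed α β T s)ᶜ := by
      have := hS.continuous_setIntegral_silent hc hp (f := fun _ => 1) continuous_const
      simpa using this
    have c2 : Continuous fun s => ∫ x in (revealed α β T s)ᶜ, φ x ∂prior μ := by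
      have := hS.continuous_setIntegral_silent hc hp (f := IccExtend zero_le_one φ)
        (φ.continuous.Icc_extend')
      simpa only [IccExtend_val] using this
    exact (c1.continuousAt.inv₀ ht.ne').mul c2.continuousAt
  refine ⟨hprior, hprob, hS.expanding.martingale_tailBelief hS.pos.le hprob, fun φ θ t => ?_,
    fun φ θ t => ?_, fun φ => ?_⟩
  · by_cases hθ : θ ∈ revealed α β T t
    · refine (continuousWithinAt_const (b := ∫ x, φ x ∂Measure.dirac θ)).congr (fun s hs => ?_) ?_
      · rw [tailBelief_of_mem (hmono hs hθ)]
      · rw [tailBelief_of_mem hθ]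
    · refine ((hcont φ t (hS.silent_real_pos hc hp h1 hθ)).congr ?_).continuousWithinAt
      filter_upwards [(hclosed θ).isOpen_compl.mem_nhds hθ] with s hs
      exact (integral_tailBelief_of_notMem hs).symm
  · by_cases hex : ∃ s < t, θ ∈ revealed α β T s
    · obtain ⟨s, hst, hs⟩ := hex
      refine ⟨∫ x, φ x ∂Measure.dirac θ, tendsto_const_nhds.congr' ?_⟩
      filter_upwards [Ioo_mem_nhdsLT hst] with u hu
      rw [tailBelief_of_mem (hmono hu.1.le hs)]
    · push Not at hex
      have hev : ∀ᶠ s in 𝓝[<] t, θ ∉ revealed α β T s := by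
        filter_upwards [self_mem_nhdsWithin] with s hs using hex s hs
      rcases (measureReal_nonneg (μ := prior μ) (s := (revealed α β T t)ᶜ)).lt_or_eq with h | h
      · refine ⟨_, ((hcont φ t h).tendsto.mono_left nhdsWithin_le_nhds).congr' ?_⟩
        filter_upwards [hev] with s hs
        exact (integral_tailBelief_of_notMem hs).symm
      · -- Everything is revealed at `t`, so the mean after silence has risen to `1`.
        have hone : β (min (t : ℝ) T) = 1 := by
          have hmem : (1 : I) ∈ revealed α β T t := by
            by_contra hn
            exact (hS.silent_real_pos hc hp h1 hn).ne h
          exact le_antisymm (hS.expanding.ordered _ (min_mem_Icc hS.pos.le t)).2.2 hmem.2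
        refine ⟨φ 1, tendsto_integral_of_tendsto_mean_one (Eventually.of_forall fun s =>
          hprob s θ) ?_ φ⟩
        have hlim := ((hS.expanding.continuous_upper hS.pos.le).tendsto t).mono_left
          (nhdsWithin_le_nhds (s := Iio t))
        rw [hone] at hlim
        refine hlim.congr' ?_
        filter_upwards [hev] with s hs
        exact (hS.mean_tailBelief_of_notMem hc hp h1 hs).symm
  · have h := setIntegral_tailBelief hprob φ (t := 0) MeasurableSet.univ (subset_univ _)
    rwa [setIntegral_univ, setIntegral_univ] at h

/-! ### The time of revelation -/

theorem revealed_end (hS : IsSilenceCurve μ r α β T) {t : ℝ≥0} (ht : T ≤ t) (θ : I) :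
    θ ∈ revealed α β T t := by
  simp only [revealed, min_eq_right ht, hS.lower_end, hS.upper_end, mem_ofPred_eq]
  exact θ.2

theorem revealTime_le_iff (hS : IsSilenceCurve μ r α β T) {t : ℝ≥0} {θ : I} :
    revealTime α β T θ ≤ t ↔ θ ∈ revealed α β T t := by
  have hne : {t : ℝ≥0 | θ ∈ revealed α β T t}.Nonempty :=
    ⟨⟨T, hS.pos.le⟩, hS.revealed_end le_rfl θ⟩
  refine ⟨fun h => hS.expanding.revealed_mono hS.pos.le h
    ((hS.expanding.isClosed_revealed hS.pos.le θ).csInf_mem hne (OrderBot.bddBelow _)),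
    fun h => csInf_le (OrderBot.bddBelow _) h⟩

theorem revealTime_le (hS : IsSilenceCurve μ r α β T) (θ : I) :
    (revealTime α β T θ : ℝ) ≤ T := by
  have := (hS.revealTime_le_iff (t := ⟨T, hS.pos.le⟩) (θ := θ)).2 (hS.revealed_end le_rfl θ)
  exact this

theorem silent_eq (hS : IsSilenceCurve μ r α β T) (t : ℝ≥0) :
    (revealed α β T t)ᶜ = {θ | t < revealTime α β T θ} := by
  ext θ
  rw [mem_compl_iff, ← hS.revealTime_le_iff, not_le]
  rfl

theorem isStoppingRule_revealTime (hS : IsSilenceCurve μ r α β T) (hc : Continuous μ)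
    (hp : ∀ x, 0 < μ x) (h1 : cdf μ 1 = 1) {H : ℝ≥0} (hH : T ≤ H) :
    IsStoppingRule H (tailFiltration (prior μ) α β T) (revealTime α β T) := by
  have hprior := isProbabilityMeasure_prior hc hp h1
  refine ⟨fun t => ?_, fun θ => NNReal.coe_le_coe.1 ((hS.revealTime_le θ).trans hH)⟩
  convert measurableSet_revealed_tailFiltration (μ₀ := prior μ) (α := α) (β := β) (T := T) t
    using 1
  ext θ
  rw [← hS.revealTime_le_iff]
  exact WithTop.coe_le_coe (a := t) (b := revealTime α β T θ)

theorem mem_revealed_revealTime (hS : IsSilenceCurve μ r α β T) (θ : I) :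
    θ ∈ revealed α β T (revealTime α β T θ) := hS.revealTime_le_iff.1 le_rfl

theorem mean_revealTime (hS : IsSilenceCurve μ r α β T) (μ₀ : Measure I) (θ : I) :
    mean (tailBelief μ₀ α β T (revealTime α β T θ) θ) = θ :=
  mean_tailBelief_of_mem (hS.mem_revealed_revealTime θ)

/-! ### Obedience of tail-censorship -/

theorem setIntegral_silent_id_eq (hS : IsSilenceCurve μ r α β T) (hc : Continuous μ)
    (hp : ∀ x, 0 < μ x) (t : ℝ≥0) :
    ∫ θ in (revealed α β T t)ᶜ, (θ : ℝ) ∂prior μ = firstMoment μ (α (min (t : ℝ) T)) +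
      (firstMoment μ 1 - firstMoment μ (β (min (t : ℝ) T))) := by
  have h := hS.setIntegral_silent hc hp continuous_id t
  simp only [id] at h
  rw [h]
  have e := integral_sub_mul hc (β (min (t : ℝ) T)) 1 0
  simp only [sub_zero, zero_mul] at e
  rw [e]
  rfl

theorem setIntegral_silent_max (hS : IsSilenceCurve μ r α β T) (hc : Continuous μ)
    (hp : ∀ x, 0 < μ x) (t : ℝ≥0) :
    ∫ θ in (revealed α β T t)ᶜ, max (θ : ℝ) (1 / 2) ∂prior μ =
      1 / 2 * cdf μ (α (min (t : ℝ) T)) +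
      (firstMoment μ 1 - firstMoment μ (β (min (t : ℝ) T))) := by
  have hm := min_mem_Icc hS.pos.le t
  have ho := hS.expanding.ordered _ hm
  have h := hS.setIntegral_silent hc hp (f := fun x => max x (1 / 2)) (by fun_prop) t
  rw [h]
  have e := integral_sub_mul hc (β (min (t : ℝ) T)) 1 0
  simp only [sub_zero, zero_mul] at e
  rw [← e, cdf, ← intervalIntegral.integral_const_mul]
  congr 1
  · refine intervalIntegral.integral_congr fun x hx => ?_
    rw [uIcc_of_le ho.1] at hx
    simp only [max_eq_right (hx.2.trans (hS.lower_le_half _ hm))]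
  · refine intervalIntegral.integral_congr fun x hx => ?_
    rw [uIcc_of_le ho.2.2] at hx
    simp only [max_eq_left ((hS.half_le_upper _ hm).trans hx.1)]

/-- The value `∫ z in 0..α c, (1/2 - z) * μ z` that the safe action adds in the low tail exactly
pays for the delay while states remain censored. This is the differential equation for the lower
endpoint in integrated form. -/
theorem integral_discounted_silent (hS : IsSilenceCurve μ r α β T) (hc : Continuous μ)
    (hp : ∀ x, 0 < μ x) (h1 : cdf μ 1 = 1) {c : ℝ} (hcI : c ∈ Icc 0 T) :
    ∫ t in c..T, r * Real.exp (-r * t) *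
        (1 / 2 * cdf μ (α t) + (firstMoment μ 1 - firstMoment μ (β t))) =
      Real.exp (-r * c) * (1 / 2 * cdf μ (α c) - firstMoment μ (α c)) := by
  have hsub : Icc c T ⊆ Icc 0 T := Icc_subset_Icc_left hcI.1
  have hcα := hS.expanding.continuousOn_lower.mono hsub
  have hcβ := hS.expanding.continuousOn_upper.mono hsub
  have hF : Continuous (cdf μ) :=
    continuous_iff_continuousAt.2 fun x => (hasDerivAt_cdf hc x).continuousAt
  have hM : Continuous (firstMoment μ) :=
    continuous_iff_continuousAt.2 fun x => (hasDerivAt_firstMoment hc x).continuousAt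
  have cF := hF.comp_continuousOn hcα
  have cM := hM.comp_continuousOn hcα
  have cM' := hM.comp_continuousOn hcβ
  have cexp : ContinuousOn (fun t => Real.exp (-r * t)) (Icc c T) := by fun_prop
  have key := intervalIntegral.integral_eq_sub_of_hasDerivAt_of_le hcI.2
    (f := fun t => -(Real.exp (-r * t) * (1 / 2 * cdf μ (α t) - firstMoment μ (α t))))
    (f' := fun t => r * Real.exp (-r * t) *
        (1 / 2 * cdf μ (α t) + (firstMoment μ 1 - firstMoment μ (β t))))
    (cexp.mul ((continuousOn_const.mul cF).sub cM)).neg ?_ ?_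
  · rw [key, hS.lower_end, cdf_zero, firstMoment_zero]
    ring
  · intro t ht
    have ht0 : 0 < t := hcI.1.trans_lt ht.1
    have htI : t ∈ Icc 0 T := ⟨ht0.le, ht.2.le⟩
    have hlt := hS.solves.1 t ⟨ht0, ht.2.le⟩
    have dα := ((hS.solves.2 t htI hlt).1).hasDerivAt (Icc_mem_nhds ht0 ht.2)
    have dF := (hasDerivAt_cdf hc (α t)).comp t dα
    have dM := (hasDerivAt_firstMoment hc (α t)).comp t dα
    have dexp : HasDerivAt (fun t => Real.exp (-r * t)) (Real.exp (-r * t) * (-r * 1)) t :=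
      ((hasDerivAt_id t).const_mul (-r)).exp
    refine (dexp.mul ((dF.const_mul (1 / 2)).sub dM)).neg.congr_deriv ?_
    have hx := hS.tailExcess_eq_zero t htI
    rw [tailExcess_eq hc h1] at hx
    have n1 : (1 / 2 - α t) ≠ 0 := by linarith
    have n2 := (hp (α t)).ne'
    have hα' : (1 / 2 * μ (α t) - α t * μ (α t)) *
        (-((cdf μ (α t) + 1 - cdf μ (β t)) / (μ (α t) * (1 / 2 - α t))) * r * β t) =
        -(cdf μ (α t) + 1 - cdf μ (β t)) * r * β t := by
      have n3 : μ (α t) * (1 / 2 - α t) ≠ 0 := mul_ne_zero n2 n1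
      have e : (1 / 2 * μ (α t) - α t * μ (α t)) = μ (α t) * (1 / 2 - α t) := by ring
      rw [e, neg_mul, neg_mul, neg_mul, neg_mul, mul_neg, ← mul_assoc, ← mul_assoc,
        mul_div_cancel₀ _ n3]
    simp only [Function.comp_apply, Pi.sub_apply]
    linear_combination (-Real.exp (-r * t)) * hα' - r * Real.exp (-r * t) * hx
  · refine ContinuousOn.intervalIntegrable ?_
    rw [uIcc_of_le hcI.2]
    exact (continuousOn_const.mul cexp).mul
      ((continuousOn_const.mul cF).add (continuousOn_const.sub cM'))

theorem measurable_revealTime (hS : IsSilenceCurve μ r α β T) :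
    Measurable (revealTime α β T) := by
  refine measurable_of_Iic fun t => ?_
  convert measurableSet_revealed α β T t using 1
  ext θ
  exact hS.revealTime_le_iff

/-- After silence up to time `c` the agent is exactly indifferent between continuing and stopping
at the posterior mean. -/
theorem setIntegral_silent_agentU (hS : IsSilenceCurve μ r α β T) (hc : Continuous μ)
    (hp : ∀ x, 0 < μ x) (h1 : cdf μ 1 = 1) (hr : 0 < r) (c : ℝ≥0) :
    ∫ θ in (revealed α β T c)ᶜ, agentU r θ (revealTime α β T θ) ∂prior μ =
      Real.exp (-r * c) * ∫ θ in (revealed α β T c)ᶜ, (θ : ℝ) ∂prior μ := by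
  have hprior := isProbabilityMeasure_prior hc hp h1
  rcases le_or_gt T c with hTc | hcT
  · have : (revealed α β T c)ᶜ = ∅ := by
      rw [compl_empty_iff]
      exact eq_univ_of_forall (hS.revealed_end hTc)
    simp [this]
  have hcI : (c : ℝ) ∈ Icc 0 T := ⟨c.2, hcT.le⟩
  have hτm := hS.measurable_revealTime
  have hNm : MeasurableSet (revealed α β T c)ᶜ := (measurableSet_revealed α β T c).compl
  set N := (revealed α β T c)ᶜ with hN
  have imax : Integrable (fun θ : I => max (θ : ℝ) (1 / 2)) (prior μ) :=
    Continuous.integrable_of_hasCompactSupport (by fun_prop) (HasCompactSupport.of_compactSpace _)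
  have hw : Continuous fun t => r * Real.exp (-r * t) := by fun_prop
  have hprim : ∀ a b : ℝ, ∫ t in a..b, r * Real.exp (-r * t) =
      Real.exp (-r * a) - Real.exp (-r * b) := by
    intro a b
    have := intervalIntegral.integral_eq_sub_of_hasDerivAt (a := a) (b := b)
      (f := fun t => -Real.exp (-r * t)) (f' := fun t => r * Real.exp (-r * t))
      (fun t _ => (((hasDerivAt_id t).const_mul (-r)).exp.neg).congr_deriv
        (by simp only [id]; ring))
      (hw.intervalIntegrable _ _)
    rw [this]; ring
  have hfub := integral_mul_intervalIntegral (imax.indicator hNm)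
    (τ := fun θ => (revealTime α β T θ : ℝ)) hτm.coe_nnreal_real (fun θ => NNReal.coe_nonneg _)
    hS.revealTime_le hS.pos.le (hw.intervalIntegrable 0 T)
  -- The integral over the states that are censored both at `t` and at `c`.
  have hinner : ∀ t : ℝ≥0, ∫ θ in {θ | (t : ℝ) < revealTime α β T θ},
      N.indicator (fun θ : I => max (θ : ℝ) (1 / 2)) θ ∂prior μ =
      ∫ θ in (revealed α β T (max t c))ᶜ, max (θ : ℝ) (1 / 2) ∂prior μ := by
    intro t
    rw [setIntegral_indicator hNm]
    congr 2
    rw [hN, hS.silent_eq, hS.silent_eq]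
    ext θ
    simp only [mem_inter_iff, mem_ofPred_eq, max_lt_iff, NNReal.coe_lt_coe]
  have hQc := hS.setIntegral_silent_max hc hp c
  rw [min_eq_left hcT.le] at hQc
  have hleft : ∫ t in (0 : ℝ)..c, r * Real.exp (-r * t) *
      ∫ θ in {θ | t < (revealTime α β T θ : ℝ)},
        N.indicator (fun θ : I => max (θ : ℝ) (1 / 2)) θ ∂prior μ =
      (1 - Real.exp (-r * c)) * ∫ θ in N, max (θ : ℝ) (1 / 2) ∂prior μ := by
    have e := hprim 0 c
    rw [mul_zero, Real.exp_zero] at e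
    rw [← e, ← intervalIntegral.integral_mul_const]
    refine intervalIntegral.integral_congr fun t ht => ?_
    rw [uIcc_of_le hcI.1] at ht
    lift t to ℝ≥0 using ht.1
    rw [hinner, max_eq_right (NNReal.coe_le_coe.1 ht.2)]
  have hright_fun : ∀ t ∈ uIcc (c : ℝ) T, r * Real.exp (-r * t) *
      ∫ θ in {θ | t < (revealTime α β T θ : ℝ)},
        N.indicator (fun θ : I => max (θ : ℝ) (1 / 2)) θ ∂prior μ =
      r * Real.exp (-r * t) *
        (1 / 2 * cdf μ (α t) + (firstMoment μ 1 - firstMoment μ (β t))) := by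
    intro t ht
    rw [uIcc_of_le hcI.2] at ht
    lift t to ℝ≥0 using hcI.1.trans ht.1
    rw [hinner, max_eq_left (NNReal.coe_le_coe.1 ht.1), hS.setIntegral_silent_max hc hp,
      min_eq_left ht.2]
  have hright := intervalIntegral.integral_congr (μ := volume) hright_fun
  rw [hS.integral_discounted_silent hc hp h1 hcI] at hright
  have hanti : Antitone fun t : ℝ => ∫ θ in {θ | t < (revealTime α β T θ : ℝ)},
        N.indicator (fun θ : I => max (θ : ℝ) (1 / 2)) θ ∂prior μ := fun s t hst =>
    setIntegral_mono_set (imax.indicator hNm).integrableOn (ae_of_all _ fun θ =>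
      indicator_nonneg (fun x _ => le_max_of_le_right (by norm_num)) θ)
      (ae_of_all _ fun θ (hθ : t < _) => lt_of_le_of_lt hst hθ)
  have hii : ∀ a b : ℝ, IntervalIntegrable (fun t => r * Real.exp (-r * t) *
      ∫ θ in {θ | t < (revealTime α β T θ : ℝ)},
        N.indicator (fun θ : I => max (θ : ℝ) (1 / 2)) θ ∂prior μ) volume a b := fun a b =>
    (hanti.intervalIntegrable).continuousOn_mul hw.continuousOn
  rw [← intervalIntegral.integral_add_adjacent_intervals (hii 0 c) (hii c T), hleft, hright] at hfub
  have hlhs : ∫ θ, N.indicator (fun θ : I => max (θ : ℝ) (1 / 2)) θ *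
      (∫ t in (0 : ℝ)..revealTime α β T θ, r * Real.exp (-r * t)) ∂prior μ =
      (∫ θ in N, max (θ : ℝ) (1 / 2) ∂prior μ) -
        ∫ θ in N, agentU r θ (revealTime α β T θ) ∂prior μ := by
    have iU : Integrable (fun θ : I => agentU r θ (revealTime α β T θ)) (prior μ) := by
      refine Integrable.of_bound (measurable_agentU measurable_subtype_coe
        hτm.coe_nnreal_real).aestronglyMeasurable 1 (ae_of_all _ fun θ => ?_)
      have h := agentU_mem_Icc hr θ.2.2 (revealTime α β T θ).2
      exact (Real.norm_of_nonneg h.1).trans_le h.2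
    rw [← integral_sub imax.integrableOn iU.integrableOn, ← integral_indicator hNm]
    refine integral_congr_ae (ae_of_all _ fun θ => ?_)
    by_cases hθ : θ ∈ N
    · simp only [indicator_of_mem hθ, hprim, agentU, mul_zero, Real.exp_zero]
      ring
    · simp only [indicator_of_notMem hθ, zero_mul]
  rw [hlhs] at hfub
  have hid := hS.setIntegral_silent_id_eq hc hp c
  rw [min_eq_left hcT.le] at hid
  rw [hid]
  linear_combination (-1 : ℝ) * hfub + Real.exp (-r * c) * hQc

theorem isObedient (hS : IsSilenceCurve μ r α β T) (hc : Continuous μ)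
    (hp : ∀ x, 0 < μ x) (h1 : cdf μ 1 = 1) (hr : 0 < r) {H : ℝ≥0} (hH : T ≤ H) :
    IsObedient r H (prior μ) (tailFiltration (prior μ) α β T) (tailBelief (prior μ) α β T)
      (revealTime α β T) := by
  have hprior := isProbabilityMeasure_prior hc hp h1
  have hX := hS.isPersuasionStrategy hc hp h1
  have hrule := hS.isStoppingRule_revealTime hc hp h1 hH
  refine ⟨hrule, fun τ' hτ' => ?_⟩
  -- `c` is the time at which `τ'` stops if silence has not been broken before.
  set C : Set ℝ≥0 := {t | (revealed α β T t)ᶜ ⊆ {θ | τ' θ ≤ t}} with hC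
  have hCne : C.Nonempty := ⟨H, fun θ _ => hτ'.2 θ⟩
  set c := sInf C with hcdef
  have hbefore : ∀ t < c, ∀ θ, t < revealTime α β T θ → t < τ' θ := by
    intro t ht θ hθ
    have hmeas : MeasurableSet[tailFiltration (prior μ) α β T t] {θ | τ' θ ≤ t} := by
      convert hτ'.1 t using 1
      ext ω
      exact (WithTop.coe_le_coe (a := t) (b := τ' ω)).symm
    have hdich := hS.expanding.subset_or_subset_compl hS.pos.le hmeas
    have hnot : t ∉ C := fun hmem => (csInf_le (OrderBot.bddBelow _) hmem).not_gt ht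
    rw [hS.silent_eq] at hdich
    have hsub := hdich.resolve_left fun h => hnot (by rwa [hC, mem_ofPred_eq, hS.silent_eq])
    exact not_le.1 (hsub hθ)
  have hlate : ∀ θ, revealTime α β T θ ≤ c → revealTime α β T θ ≤ τ' θ := fun θ hθ => by
    by_contra! hlt
    exact lt_irrefl _ (hbefore (τ' θ) (hlt.trans_le hθ) θ hlt)
  have hsilent : ∀ θ, c < revealTime α β T θ → τ' θ = c := fun θ hθ => by
    refine le_antisymm ?_ ?_
    · by_contra! hlt
      obtain ⟨s, hsC, hs⟩ := exists_lt_of_csInf_lt hCne (lt_min hlt hθ)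
      have hmem : θ ∈ (revealed α β T s)ᶜ := by
        rw [hS.silent_eq]
        exact hs.trans_le (min_le_right _ _)
      exact ((hsC hmem).trans_lt (hs.trans_le (min_le_left _ _))).false
    · by_contra! hlt
      exact lt_irrefl _ (hbefore (τ' θ) hlt θ (hlt.trans hθ))
  have hRm := measurableSet_revealed α β T c
  have i1 := hX.integrable_agentU_stopped hr hτ'.measurable
  have i2 := hX.integrable_agentU_stopped hr hrule.measurable
  rw [agentPayoff, agentPayoff, ← integral_add_compl hRm i1, ← integral_add_compl hRm i2]
  refine add_le_add ?_ (le_of_eq ?_)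
  · refine setIntegral_mono_on i1.integrableOn i2.integrableOn hRm fun θ hθ => ?_
    have hle := hlate θ (hS.revealTime_le_iff.2 hθ)
    rw [hS.mean_revealTime, mean_tailBelief_of_mem (hS.revealTime_le_iff.1 hle)]
    refine mul_le_mul_of_nonneg_right (Real.exp_le_exp.2 ?_) (le_max_of_le_right (by norm_num))
    have : (revealTime α β T θ : ℝ) ≤ τ' θ := NNReal.coe_le_coe.2 hle
    nlinarith
  · have e1 : ∀ θ ∈ (revealed α β T c)ᶜ,
        agentU r (mean (tailBelief (prior μ) α β T (τ' θ) θ)) (τ' θ) =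
          Real.exp (-r * c) * β (min (c : ℝ) T) := fun θ hθ => by
      have hlt : c < revealTime α β T θ := by
        rw [hS.silent_eq] at hθ; exact hθ
      rw [hsilent θ hlt, hS.mean_tailBelief_of_notMem hc hp h1 hθ, agentU,
        max_eq_left (hS.half_le_upper _ (min_mem_Icc hS.pos.le c))]
    rw [setIntegral_congr_fun hRm.compl e1, setIntegral_const, smul_eq_mul]
    simp only [hS.mean_revealTime]
    rw [hS.setIntegral_silent_agentU hc hp h1 hr, hS.setIntegral_silent_id hc hp h1]
    ring

end IsSilenceCurve

/-! ### Properties of the Lagrangian -/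

section Lagrangian

variable {r θlow p mass H : ℝ} {w : ℝ → ℝ}

theorem lagrangian_eq_affine (r θlow p mass : ℝ) (w : ℝ → ℝ) (m t : ℝ) :
    lagrangian r θlow p mass w m t =
      (t - mass * p - ∫ s in (0 : ℝ)..t, w s * Real.exp (-r * s)) * m +
        (-(θlow * t) - mass * ((1 - p) / 2)) +
        (mass + ∫ s in (0 : ℝ)..t, w s) * Real.exp (-r * t) * max m (1 / 2) := by
  rw [lagrangian, principalV, agentU]
  ring

/-- The Lagrangian is convex in the mean: it is better to learn the state when stopping. -/
theorem lagrangian_mean_le (hmass : 0 ≤ mass) {t : ℝ} (ht : 0 ≤ t) (hw0 : ∀ s ∈ Icc 0 t, 0 ≤ w s)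
    (ν : Measure I) [IsProbabilityMeasure ν] :
    lagrangian r θlow p mass w (mean ν) t ≤ ∫ θ : I, lagrangian r θlow p mass w θ t ∂ν := by
  have hW : 0 ≤ ∫ s in (0 : ℝ)..t, w s := intervalIntegral.integral_nonneg ht hw0
  simp only [lagrangian_eq_affine]
  set a := t - mass * p - ∫ s in (0 : ℝ)..t, w s * Real.exp (-r * s)
  set b := -(θlow * t) - mass * ((1 - p) / 2)
  set c := (mass + ∫ s in (0 : ℝ)..t, w s) * Real.exp (-r * t)
  have hcc : 0 ≤ c := mul_nonneg (by linarith) (Real.exp_pos _).le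
  have iid : Integrable (fun θ : I => (θ : ℝ)) ν :=
    continuous_subtype_val.integrable_of_hasCompactSupport (HasCompactSupport.of_compactSpace _)
  have imax : Integrable (fun θ : I => max (θ : ℝ) (1 / 2)) ν :=
    Continuous.integrable_of_hasCompactSupport (by fun_prop) (HasCompactSupport.of_compactSpace _)
  have i1 : Integrable (fun θ : I => a * (θ : ℝ) + b) ν :=
    (iid.const_mul a).add (integrable_const b)
  rw [integral_add i1 (imax.const_mul c), integral_add (iid.const_mul a) (integrable_const b),
    integral_const_mul, integral_const_mul, integral_const, probReal_univ, one_smul]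
  refine add_le_add le_rfl (mul_le_mul_of_nonneg_left (max_le ?_ ?_) hcc)
  · exact integral_mono iid imax fun θ => le_max_left _ _
  · calc (1 / 2 : ℝ) = ∫ _, (1 / 2 : ℝ) ∂ν := by simp
      _ ≤ _ := integral_mono (integrable_const _) imax fun θ => le_max_right _ _

theorem exists_lipschitz_lagrangian (hH0 : 0 ≤ H) (hw : IntervalIntegrable w volume 0 H) :
    ∃ K, ∀ t ∈ Icc 0 H, ∀ m m' : ℝ,
      lagrangian r θlow p mass w m t ≤ lagrangian r θlow p mass w m' t + K * |m - m'| := by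
  have c1 := continuousOn_primitive_Icc hH0 hw
  have c2 := continuousOn_primitive_Icc hH0 (intervalIntegrable_mul_exp hw r)
  obtain ⟨K₁, hK₁⟩ := isCompact_Icc.exists_bound_of_continuousOn
    (show ContinuousOn (fun t => t - mass * p - ∫ s in (0 : ℝ)..t, w s * Real.exp (-r * s))
      (Icc 0 H) from (continuousOn_id.sub continuousOn_const).sub c2)
  obtain ⟨K₂, hK₂⟩ := isCompact_Icc.exists_bound_of_continuousOn
    (show ContinuousOn (fun t => (mass + ∫ s in (0 : ℝ)..t, w s) * Real.exp (-r * t))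
      (Icc 0 H) from (continuousOn_const.add c1).mul (by fun_prop))
  refine ⟨K₁ + K₂, fun t ht m m' => ?_⟩
  have h1 := hK₁ t ht
  have h2 := hK₂ t ht
  simp only [lagrangian_eq_affine]
  set a := t - mass * p - ∫ s in (0 : ℝ)..t, w s * Real.exp (-r * s)
  set c := (mass + ∫ s in (0 : ℝ)..t, w s) * Real.exp (-r * t)
  have e1 : a * (m - m') ≤ K₁ * |m - m'| := by
    refine (le_abs_self _).trans ?_
    rw [abs_mul]
    exact mul_le_mul_of_nonneg_right h1 (abs_nonneg _)
  have e2 : c * (max m (1 / 2) - max m' (1 / 2)) ≤ K₂ * |m - m'| := by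
    refine (le_abs_self _).trans ?_
    rw [abs_mul]
    exact mul_le_mul h2 (abs_max_sub_max_le_abs _ _ _) (abs_nonneg _) ((norm_nonneg _).trans h2)
  linarith

end Lagrangian

/-! ### The multiplier -/

/-- The discounted multiplier mass accumulated by time `t`. It is chosen such that the derivative
of the Lagrangian in the stopping time vanishes at the mean `β t`. -/
noncomputable def shadowMass (r θlow : ℝ) (β : ℝ → ℝ) (T t : ℝ) : ℝ :=
  (1 - θlow / β (min t T)) / r

/-- The derivative of `shadowMass`. -/
noncomputable def shadowRate (θlow : ℝ) (α β : ℝ → ℝ) (T t : ℝ) : ℝ :=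
  if t < T then θlow * (β t - α t) / ((1 / 2 - α t) * β t) else 0

/-- The density of the multiplier on the continuation constraints. -/
noncomputable def shadowDensity (r θlow : ℝ) (α β : ℝ → ℝ) (T t : ℝ) : ℝ :=
  Real.exp (r * t) * (1 - θlow / β (min t T) + shadowRate θlow α β T t)

/-- The derivative of the Lagrangian in the stopping time, at the mean `m`. -/
noncomputable def lagrangianRate (θlow : ℝ) (α β : ℝ → ℝ) (T m t : ℝ) : ℝ :=
  θlow * (m / β (min t T) - 1) + (max m (1 / 2) - m) * shadowRate θlow α β T t

theorem integral_eq_sub_of_hasDerivAt_off_point {F f : ℝ → ℝ} {H T : ℝ}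
    (hF : ContinuousOn F (Icc 0 H)) (hd : ∀ t ∈ Ioo 0 H, t ≠ T → HasDerivAt F (f t) t)
    (hf : IntervalIntegrable f volume 0 H) {t : ℝ} (ht : t ∈ Icc 0 H) :
    ∫ s in (0 : ℝ)..t, f s = F t - F 0 :=
  integral_eq_of_hasDerivAt_off_countable_of_le F f ht.1 (countable_singleton T)
    (hF.mono (Icc_subset_Icc_right ht.2))
    (fun s hs => hd s ⟨hs.1.1, hs.1.2.trans_le ht.2⟩ hs.2)
    (hf.mono_set (by
      rw [uIcc_of_le ht.1, uIcc_of_le (ht.1.trans ht.2)]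
      exact Icc_subset_Icc_right ht.2))

namespace IsSilenceCurve

variable {r : ℝ} {α β : ℝ → ℝ} {T : ℝ} {θlow H : ℝ}

theorem min_mem (hS : IsSilenceCurve μ r α β T) {t : ℝ} (ht : 0 ≤ t) : min t T ∈ Icc 0 T :=
  ⟨le_min ht hS.pos.le, min_le_right _ _⟩

theorem continuousOn_upper_min (hS : IsSilenceCurve μ r α β T) :
    ContinuousOn (fun t => β (min t T)) (Icc 0 H) :=
  hS.expanding.continuousOn_upper.comp (by fun_prop) fun _ ht => hS.min_mem ht.1

theorem upper_min_pos (hS : IsSilenceCurve μ r α β T) {t : ℝ} (ht : 0 ≤ t) :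
    0 < β (min t T) := by
  linarith [hS.half_le_upper _ (hS.min_mem ht)]

theorem low_le_upper (hS : IsSilenceCurve μ r α β T) (hlow : θlow ≤ β 0) {t : ℝ} (ht : 0 ≤ t) :
    θlow ≤ β (min t T) :=
  hlow.trans (hS.expanding.monotoneOn_upper ⟨le_rfl, hS.pos.le⟩ (hS.min_mem ht) (hS.min_mem ht).1)

theorem continuousOn_shadowMass (hS : IsSilenceCurve μ r α β T) :
    ContinuousOn (shadowMass r θlow β T) (Icc 0 H) :=
  (continuousOn_const.sub (continuousOn_const.div hS.continuousOn_upper_min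
    fun _ ht => (hS.upper_min_pos ht.1).ne')).div_const r

theorem shadowMass_nonneg (hS : IsSilenceCurve μ r α β T) (hr : 0 < r) (hlow : θlow ≤ β 0)
    {t : ℝ} (ht : 0 ≤ t) : 0 ≤ shadowMass r θlow β T t := by
  have h1 : θlow / β (min t T) ≤ 1 :=
    (div_le_one (hS.upper_min_pos ht)).2 (hS.low_le_upper hlow ht)
  exact div_nonneg (by linarith) hr.le

theorem shadowRate_nonneg (hS : IsSilenceCurve μ r α β T) (hlow0 : 0 ≤ θlow) {t : ℝ}
    (ht : 0 ≤ t) : 0 ≤ shadowRate θlow α β T t := by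
  rw [shadowRate]
  split_ifs with h
  · have hI : t ∈ Icc 0 T := ⟨ht, h.le⟩
    have h1 := hS.expanding.ordered t hI
    have h2 := hS.lower_le_half t hI
    have h3 := hS.half_le_upper t hI
    exact div_nonneg (mul_nonneg hlow0 (by linarith)) (mul_nonneg (by linarith) (by linarith))
  · exact le_rfl

theorem shadowDensity_nonneg (hS : IsSilenceCurve μ r α β T) (hlow0 : 0 ≤ θlow)
    (hlow : θlow ≤ β 0) {t : ℝ} (ht : 0 ≤ t) : 0 ≤ shadowDensity r θlow α β T t := by
  have h1 : θlow / β (min t T) ≤ 1 :=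
    (div_le_one (hS.upper_min_pos ht)).2 (hS.low_le_upper hlow ht)
  exact mul_nonneg (Real.exp_pos _).le (by linarith [hS.shadowRate_nonneg hlow0 ht])

theorem hasDerivAt_shadowMass (hS : IsSilenceCurve μ r α β T) (hr : 0 < r) {t : ℝ} (ht : 0 < t)
    (hne : t ≠ T) : HasDerivAt (shadowMass r θlow β T) (shadowRate θlow α β T t) t := by
  rcases lt_or_gt_of_ne hne with h | h
  · have hI : t ∈ Icc 0 T := ⟨ht.le, h.le⟩
    have hlt := hS.solves.1 t ⟨ht, h.le⟩
    have hd := ((hS.solves.2 t hI hlt).2).hasDerivAt (Icc_mem_nhds ht h)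
    have hβ := hS.half_le_upper t hI
    have n1 : β t ≠ 0 := by linarith
    have n2 : 1 / 2 - α t ≠ 0 := by linarith
    have hd' : HasDerivAt (fun t => (1 - θlow / β t) / r) (shadowRate θlow α β T t) t := by
      refine ((((hasDerivAt_const t θlow).div hd n1).const_sub 1).div_const r).congr_deriv ?_
      rw [shadowRate, if_pos h]
      field_simp
      ring
    refine hd'.congr_of_eventuallyEq ?_
    filter_upwards [Iio_mem_nhds h] with s hs
    rw [shadowMass, min_eq_left (le_of_lt hs)]
  · rw [shadowRate, if_neg h.not_gt]
    refine (hasDerivAt_const t ((1 - θlow / β T) / r)).congr_of_eventuallyEq ?_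
    filter_upwards [Ioi_mem_nhds h] with s hs
    rw [shadowMass, min_eq_right (le_of_lt hs)]

theorem intervalIntegrable_shadowRate (hS : IsSilenceCurve μ r α β T) (hr : 0 < r)
    (hlow0 : 0 ≤ θlow) (hH : T ≤ H) :
    IntervalIntegrable (shadowRate θlow α β T) volume 0 H := by
  have i1 : IntervalIntegrable (shadowRate θlow α β T) volume 0 T := by
    have hmin : min 0 T = 0 := min_eq_left hS.pos.le
    have hmax : max 0 T = T := max_eq_right hS.pos.le
    refine intervalIntegral.intervalIntegrable_deriv_of_nonneg (g := shadowMass r θlow β T) ?_ ?_ ?_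
    · rw [uIcc_of_le hS.pos.le]
      exact hS.continuousOn_shadowMass
    · rw [hmin, hmax]
      exact fun t ht => hS.hasDerivAt_shadowMass hr ht.1 ht.2.ne
    · rw [hmin, hmax]
      exact fun t ht => hS.shadowRate_nonneg hlow0 ht.1.le
  refine i1.trans ((intervalIntegrable_const (c := (0 : ℝ))).congr fun t ht => ?_)
  rw [uIoc_of_le hH] at ht
  rw [shadowRate, if_neg ht.1.le.not_gt]

theorem integral_shadowRate (hS : IsSilenceCurve μ r α β T) (hr : 0 < r)
    (hlow0 : 0 ≤ θlow) (hH : T ≤ H) {t : ℝ} (ht : t ∈ Icc 0 H) :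
    ∫ s in (0 : ℝ)..t, shadowRate θlow α β T s =
      shadowMass r θlow β T t - shadowMass r θlow β T 0 :=
  integral_eq_sub_of_hasDerivAt_off_point hS.continuousOn_shadowMass
    (fun _ hs hne => hS.hasDerivAt_shadowMass hr hs.1 hne)
    (hS.intervalIntegrable_shadowRate hr hlow0 hH) ht

theorem continuousOn_div_upper (hS : IsSilenceCurve μ r α β T) (m : ℝ) :
    ContinuousOn (fun t => m / β (min t T)) (Icc 0 H) :=
  continuousOn_const.div hS.continuousOn_upper_min fun _ ht => (hS.upper_min_pos ht.1).ne'

theorem intervalIntegrable_div_upper (hS : IsSilenceCurve μ r α β T) (m : ℝ) {t : ℝ}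
    (ht : 0 ≤ t) : IntervalIntegrable (fun t => m / β (min t T)) volume 0 t := by
  refine ContinuousOn.intervalIntegrable ?_
  rw [uIcc_of_le ht]
  exact hS.continuousOn_div_upper m

theorem intervalIntegrable_shadowDensity (hS : IsSilenceCurve μ r α β T) (hr : 0 < r)
    (hlow0 : 0 ≤ θlow) (hH : T ≤ H) :
    IntervalIntegrable (shadowDensity r θlow α β T) volume 0 H :=
  (((intervalIntegrable_const (c := (1 : ℝ))).sub
    (hS.intervalIntegrable_div_upper θlow (hS.pos.le.trans hH))).add
    (hS.intervalIntegrable_shadowRate hr hlow0 hH)).continuousOn_mul (by fun_prop)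

theorem integral_shadowDensity (hS : IsSilenceCurve μ r α β T) (hr : 0 < r)
    (hlow0 : 0 ≤ θlow) (hH : T ≤ H) {t : ℝ} (ht : t ∈ Icc 0 H) :
    ∫ s in (0 : ℝ)..t, shadowDensity r θlow α β T s =
      Real.exp (r * t) * shadowMass r θlow β T t - shadowMass r θlow β T 0 := by
  have h := integral_eq_sub_of_hasDerivAt_off_point (T := T)
    (F := fun t => Real.exp (r * t) * shadowMass r θlow β T t)
    (f := shadowDensity r θlow α β T)
    (ContinuousOn.mul (by fun_prop) hS.continuousOn_shadowMass) (fun s hs hne => ?_)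
    (hS.intervalIntegrable_shadowDensity hr hlow0 hH) ht
  · simpa using h
  · have hexp : HasDerivAt (fun t => Real.exp (r * t)) (Real.exp (r * s) * (r * 1)) s :=
      ((hasDerivAt_id s).const_mul r).exp
    refine (hexp.mul (hS.hasDerivAt_shadowMass (θlow := θlow) hr hs.1 hne)).congr_deriv ?_
    rw [shadowDensity, shadowMass]
    field_simp

theorem integral_shadowDensity_mul_exp (hS : IsSilenceCurve μ r α β T) (hr : 0 < r)
    (hlow0 : 0 ≤ θlow) (hH : T ≤ H) {t : ℝ} (ht : t ∈ Icc 0 H) :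
    ∫ s in (0 : ℝ)..t, shadowDensity r θlow α β T s * Real.exp (-r * s) =
      t - (∫ s in (0 : ℝ)..t, θlow / β (min s T)) +
        (shadowMass r θlow β T t - shadowMass r θlow β T 0) := by
  have e : ∀ s, shadowDensity r θlow α β T s * Real.exp (-r * s) =
      1 - θlow / β (min s T) + shadowRate θlow α β T s := fun s => by
    rw [shadowDensity, mul_right_comm, ← Real.exp_add]
    simp
  have i1 := hS.intervalIntegrable_div_upper θlow ht.1
  have i2 : IntervalIntegrable (shadowRate θlow α β T) volume 0 t :=
    (hS.intervalIntegrable_shadowRate hr hlow0 hH).mono_set (by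
      rw [uIcc_of_le ht.1, uIcc_of_le (ht.1.trans ht.2)]
      exact Icc_subset_Icc_right ht.2)
  simp only [e]
  rw [intervalIntegral.integral_add (intervalIntegrable_const.sub i1) i2,
    intervalIntegral.integral_sub intervalIntegrable_const i1,
    hS.integral_shadowRate hr hlow0 hH ht]
  simp

theorem intervalIntegrable_lagrangianRate (hS : IsSilenceCurve μ r α β T) (hr : 0 < r)
    (hlow0 : 0 ≤ θlow) (hH : T ≤ H) (m : ℝ) :
    IntervalIntegrable (lagrangianRate θlow α β T m) volume 0 H :=
  (((hS.intervalIntegrable_div_upper m (hS.pos.le.trans hH)).sub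
    intervalIntegrable_const).const_mul θlow).add
    ((hS.intervalIntegrable_shadowRate hr hlow0 hH).const_mul _)

theorem lagrangian_eq (hS : IsSilenceCurve μ r α β T) (hr : 0 < r)
    (hlow0 : 0 ≤ θlow) (hH : T ≤ H) (p m : ℝ) {t : ℝ} (ht : t ∈ Icc 0 H) :
    lagrangian r θlow p (shadowMass r θlow β T 0) (shadowDensity r θlow α β T) m t =
      shadowMass r θlow β T 0 * (max m (1 / 2) - (p * m + (1 - p) / 2)) +
        ∫ s in (0 : ℝ)..t, lagrangianRate θlow α β T m s := by
  have i1 := hS.intervalIntegrable_div_upper m ht.1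
  have i2 : IntervalIntegrable (shadowRate θlow α β T) volume 0 t :=
    (hS.intervalIntegrable_shadowRate hr hlow0 hH).mono_set (by
      rw [uIcc_of_le ht.1, uIcc_of_le (ht.1.trans ht.2)]
      exact Icc_subset_Icc_right ht.2)
  have e : ∀ x : ℝ, ∫ s in (0 : ℝ)..t, x / β (min s T) =
      x * ∫ s in (0 : ℝ)..t, 1 / β (min s T) := fun x => by
    rw [← intervalIntegral.integral_const_mul]
    simp only [mul_one_div]
  have hexp : Real.exp (-r * t) * Real.exp (r * t) = 1 := by
    rw [← Real.exp_add]; simp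
  simp only [lagrangianRate]
  rw [lagrangian, principalV, agentU, hS.integral_shadowDensity hr hlow0 hH ht,
    hS.integral_shadowDensity_mul_exp hr hlow0 hH ht,
    intervalIntegral.integral_add ((i1.sub intervalIntegrable_const).const_mul θlow)
      (i2.const_mul _), intervalIntegral.integral_const_mul, intervalIntegral.integral_const_mul,
    intervalIntegral.integral_sub i1 intervalIntegrable_const,
    hS.integral_shadowRate hr hlow0 hH ht, e m, e θlow, intervalIntegral.integral_const]
  simp only [smul_eq_mul, sub_zero, mul_one]
  linear_combination (max m (1 / 2) * shadowMass r θlow β T t) * hexp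

theorem lagrangianRate_of_lt (hS : IsSilenceCurve μ r α β T) {m t : ℝ} (hm : m ≤ 1 / 2)
    (ht : t ∈ Ioo 0 T) : lagrangianRate θlow α β T m t =
      θlow * (β t - 1 / 2) / (β t * (1 / 2 - α t)) * (α t - m) := by
  have h1 := hS.solves.1 t ⟨ht.1, ht.2.le⟩
  have h2 := hS.half_le_upper t ⟨ht.1.le, ht.2.le⟩
  have n1 : β t ≠ 0 := by linarith
  have n2 : 1 / 2 - α t ≠ 0 := by linarith
  have n3 : 1 - 2 * α t ≠ 0 := by linarith
  rw [lagrangianRate, shadowRate, if_pos ht.2, min_eq_left ht.2.le, max_eq_right hm]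
  field_simp
  ring

theorem lagrangianRate_nonneg (hS : IsSilenceCurve μ r α β T) (hlow0 : 0 ≤ θlow) {θ : I} {t : ℝ}
    (ht0 : 0 < t) (ht : t < revealTime α β T θ) : 0 ≤ lagrangianRate θlow α β T θ t := by
  have htT : t < T := ht.trans_le (hS.revealTime_le θ)
  have hI : t ∈ Icc 0 T := ⟨ht0.le, htT.le⟩
  have h1 := hS.solves.1 t ⟨ht0, htT.le⟩
  have h2 := hS.half_le_upper t hI
  lift t to ℝ≥0 using ht0.le
  have hθ : θ ∉ revealed α β T t := by
    rw [← hS.revealTime_le_iff, not_le]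
    exact NNReal.coe_lt_coe.1 ht
  simp only [revealed, mem_ofPred_eq, min_eq_left htT.le, not_and_or, not_le] at hθ
  rcases hθ with hθ | hθ
  · rw [hS.lagrangianRate_of_lt (hθ.le.trans h1.le) ⟨ht0, htT⟩]
    have h3 : 0 ≤ β t - 1 / 2 := by linarith
    have h4 : 0 ≤ 1 / 2 - α t := by linarith
    have h5 : 0 ≤ α t - θ := by linarith
    have h6 : 0 ≤ β t := by linarith
    positivity
  · rw [lagrangianRate, min_eq_left htT.le, max_eq_left (h2.trans hθ.le), sub_self, zero_mul,
      add_zero]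
    have : 1 ≤ θ / β t := (one_le_div (by linarith)).2 hθ.le
    exact mul_nonneg hlow0 (by linarith)

theorem lagrangianRate_nonpos (hS : IsSilenceCurve μ r α β T) (hlow0 : 0 ≤ θlow) {θ : I} {t : ℝ}
    (ht0 : 0 < t) (ht : revealTime α β T θ ≤ t) : lagrangianRate θlow α β T θ t ≤ 0 := by
  have hupper : (θ : ℝ) ≤ β (min t T) → shadowRate θlow α β T t = 0 ∨ 1 / 2 ≤ (θ : ℝ) →
      lagrangianRate θlow α β T θ t ≤ 0 := by
    intro hle hor
    have hz : (max (θ : ℝ) (1 / 2) - θ) * shadowRate θlow α β T t = 0 := by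
      rcases hor with h | h
      · rw [h, mul_zero]
      · rw [max_eq_left h, sub_self, zero_mul]
    rw [lagrangianRate, hz, add_zero]
    have : θ / β (min t T) ≤ 1 := (div_le_one (hS.upper_min_pos ht0.le)).2 hle
    exact mul_nonpos_of_nonneg_of_nonpos hlow0 (by linarith)
  have hθ : θ ∈ revealed α β T ⟨t, ht0.le⟩ := hS.revealTime_le_iff.1 (NNReal.coe_le_coe.1 ht)
  have hθ1 : α (min t T) ≤ θ := hθ.1
  have hθ2 : (θ : ℝ) ≤ β (min t T) := hθ.2
  rcases le_or_gt T t with hT | hT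
  · exact hupper hθ2 (Or.inl (by rw [shadowRate, if_neg hT.not_gt]))
  rcases le_or_gt (1 / 2) (θ : ℝ) with hh | hh
  · exact hupper hθ2 (Or.inr hh)
  rw [hS.lagrangianRate_of_lt hh.le ⟨ht0, hT⟩]
  rw [min_eq_left hT.le] at hθ1
  have h1 := hS.solves.1 t ⟨ht0, hT.le⟩
  have h2 := hS.half_le_upper t ⟨ht0.le, hT.le⟩
  refine mul_nonpos_of_nonneg_of_nonpos (div_nonneg (mul_nonneg hlow0 (by linarith))
    (mul_nonneg (by linarith) (by linarith))) (by linarith)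

/-- Each state is revealed at the time that maximises the Lagrangian. -/
theorem lagrangian_le_revealTime (hS : IsSilenceCurve μ r α β T) (hr : 0 < r)
    (hlow0 : 0 ≤ θlow) (hH : T ≤ H) (p : ℝ) (θ : I) {t : ℝ} (ht : t ∈ Icc 0 H) :
    lagrangian r θlow p (shadowMass r θlow β T 0) (shadowDensity r θlow α β T) θ t ≤
      lagrangian r θlow p (shadowMass r θlow β T 0) (shadowDensity r θlow α β T) θ
        (revealTime α β T θ) := by
  obtain ⟨u, hu⟩ : ∃ u : ℝ, u = revealTime α β T θ := ⟨_, rfl⟩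
  have hu0 : 0 ≤ u := hu ▸ NNReal.coe_nonneg _
  have huI : u ∈ Icc 0 H := ⟨hu0, hu ▸ (hS.revealTime_le θ).trans hH⟩
  rw [← hu]
  rw [hS.lagrangian_eq hr hlow0 hH p _ ht, hS.lagrangian_eq hr hlow0 hH p _ huI]
  have hi : ∀ x ∈ Icc 0 H, ∀ y ∈ Icc 0 H,
      IntervalIntegrable (lagrangianRate θlow α β T θ) volume x y := fun x hx y hy =>
    (hS.intervalIntegrable_lagrangianRate hr hlow0 hH θ).mono_set (by
      rw [uIcc_of_le (ht.1.trans ht.2)]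
      exact ordConnected_Icc.uIcc_subset hx hy)
  have h0 : (0 : ℝ) ∈ Icc 0 H := ⟨le_rfl, ht.1.trans ht.2⟩
  have hadd := intervalIntegral.integral_add_adjacent_intervals (hi 0 h0 t ht) (hi t ht u huI)
  have hnonneg : 0 ≤ ∫ s in t..u, lagrangianRate θlow α β T θ s := by
    rcases le_total t u with htu | hut
    · have := intervalIntegral.integral_mono_on_of_le_Ioo htu
        (intervalIntegrable_const (c := (0 : ℝ))) (hi t ht u huI)
        fun s hs => hS.lagrangianRate_nonneg hlow0 (ht.1.trans_lt hs.1) (hu ▸ hs.2)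
      simpa using this
    · rw [intervalIntegral.integral_symm]
      have := intervalIntegral.integral_mono_on_of_le_Ioo hut (hi u huI t ht)
        (intervalIntegrable_const (c := (0 : ℝ)))
        fun s hs => hS.lagrangianRate_nonpos hlow0 (hu0.trans_lt hs.1) (hu ▸ hs.1.le)
      simp only [intervalIntegral.integral_zero] at this
      linarith
  linarith

end IsSilenceCurve

/-! ### Optimality -/

namespace IsSilenceCurve

variable {r : ℝ} {α β : ℝ → ℝ} {T : ℝ} {θlow : ℝ}

theorem revealTime_eq_zero (hS : IsSilenceCurve μ r α β T) {θ : I}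
    (hθ : θ ∈ revealed α β T 0) : revealTime α β T θ = 0 :=
  le_antisymm (hS.revealTime_le_iff.2 hθ) zero_le

/-- Complementary slackness at time `0`. If the prior mean is so low that the interval starts at
`β 0 = 1/2`, the binding deviation takes the safe payoff `1/2`; otherwise it takes the mean. -/
theorem exists_initial_slack (hS : IsSilenceCurve μ r α β T) (hc : Continuous μ)
    (hp : ∀ x, 0 < μ x) (h1 : cdf μ 1 = 1) (hr : 0 < r)
    (hinit : β 0 = θlow ∨ α 0 = 1 / 2 ∨ β 0 = 1 / 2) :
    ∃ p : ℝ, 0 ≤ p ∧ p ≤ 1 ∧ shadowMass r θlow β T 0 *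
      (∫ θ : I, agentU r θ (revealTime α β T θ) ∂prior μ -
        ∫ θ : I, (p * (θ : ℝ) + (1 - p) / 2) ∂prior μ) = 0 := by
  have hprior := isProbabilityMeasure_prior hc hp h1
  have hX := hS.isPersuasionStrategy hc hp h1
  have hmin : min ((0 : ℝ≥0) : ℝ) T = 0 := by
    rw [NNReal.coe_zero]; exact min_eq_left hS.pos.le
  have iU : Integrable (fun θ : I => agentU r θ (revealTime α β T θ)) (prior μ) := by
    have := hX.integrable_agentU_stopped hr hS.measurable_revealTime
    simpa only [hS.mean_revealTime] using this
  have iid : Integrable (fun θ : I => (θ : ℝ)) (prior μ) :=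
    continuous_subtype_val.integrable_of_hasCompactSupport (HasCompactSupport.of_compactSpace _)
  have hRm := measurableSet_revealed α β T 0
  have hN := hS.setIntegral_silent_agentU hc hp h1 hr 0
  rw [NNReal.coe_zero, mul_zero, Real.exp_zero, one_mul] at hN
  have hU0 : ∀ θ ∈ revealed α β T 0, agentU r θ (revealTime α β T θ) = max (θ : ℝ) (1 / 2) := by
    intro θ hθ
    rw [hS.revealTime_eq_zero hθ, agentU, NNReal.coe_zero, mul_zero, Real.exp_zero, one_mul]
  rcases hinit with h | h | h
  · refine ⟨1, zero_le_one, le_rfl, ?_⟩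
    have h0 : β 0 ≠ 0 := by
      have := hS.half_le_upper 0 ⟨le_rfl, hS.pos.le⟩
      linarith
    rw [shadowMass, min_eq_left hS.pos.le, ← h, div_self h0, sub_self, zero_div, zero_mul]
  · refine ⟨1, zero_le_one, le_rfl, mul_eq_zero_of_right _ (sub_eq_zero.2 ?_)⟩
    simp only [one_mul, sub_self, zero_div, add_zero]
    rw [← integral_add_compl hRm iU, ← integral_add_compl hRm iid, hN,
      setIntegral_congr_fun hRm fun θ hθ => ?_]
    have hθ1 : α (min ((0 : ℝ≥0) : ℝ) T) ≤ θ := hθ.1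
    rw [hmin, h] at hθ1
    rw [hU0 θ hθ, max_eq_left hθ1]
  · refine ⟨0, le_rfl, zero_le_one, mul_eq_zero_of_right _ (sub_eq_zero.2 ?_)⟩
    have hS0 := hS.setIntegral_silent_id hc hp h1 0
    rw [hmin, h] at hS0
    simp only [zero_mul, zero_add, sub_zero]
    rw [← integral_add_compl hRm iU, ← integral_add_compl hRm (integrable_const _), hN, hS0,
      setIntegral_const (s := (revealed α β T 0)ᶜ), smul_eq_mul, mul_comm (1 / 2 : ℝ),
      setIntegral_congr_fun hRm fun θ hθ => ?_]
    have hθ2 : (θ : ℝ) ≤ β (min ((0 : ℝ≥0) : ℝ) T) := hθ.2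
    rw [hmin, h] at hθ2
    rw [hU0 θ hθ, max_eq_right hθ2]

theorem principalPayoff_revealTime (hS : IsSilenceCurve μ r α β T) :
    principalPayoff θlow (prior μ) (tailBelief (prior μ) α β T) (revealTime α β T) =
      ∫ θ : I, principalV θlow θ (revealTime α β T θ) ∂prior μ := by
  simp only [principalPayoff, hS.mean_revealTime]

/-- The states' maximised Lagrangians average to the payoff of tail-censorship, because the
weighted constraints bind. -/
theorem integral_lagrangian_revealTime (hS : IsSilenceCurve μ r α β T) (hc : Continuous μ)
    (hp : ∀ x, 0 < μ x) (h1 : cdf μ 1 = 1) (hr : 0 < r) (hlow0 : 0 ≤ θlow) {H : ℝ} (hH : T ≤ H)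
    {p : ℝ} (hslack : shadowMass r θlow β T 0 *
      (∫ θ : I, agentU r θ (revealTime α β T θ) ∂prior μ -
        ∫ θ : I, (p * (θ : ℝ) + (1 - p) / 2) ∂prior μ) = 0) :
    ∫ θ : I, lagrangian r θlow p (shadowMass r θlow β T 0) (shadowDensity r θlow α β T) θ
        (revealTime α β T θ) ∂prior μ =
      ∫ θ : I, principalV θlow θ (revealTime α β T θ) ∂prior μ := by
  have hprior := isProbabilityMeasure_prior hc hp h1
  have hH0 : 0 ≤ H := hS.pos.le.trans hH
  have key := (integral_lagrangian (P := prior μ) (θlow := θlow) (p := p)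
    (mass := shadowMass r θlow β T 0) hr hH0
    (hS.intervalIntegrable_shadowDensity (θlow := θlow) hr hlow0 hH)
    (m := fun θ : I => (θ : ℝ)) (τ := fun θ => (revealTime α β T θ : ℝ)) measurable_subtype_coe
    (fun θ => θ.2) hS.measurable_revealTime.coe_nnreal_real
    fun θ => ⟨NNReal.coe_nonneg _, (hS.revealTime_le θ).trans hH⟩).2
  rw [key, hslack, add_zero, add_eq_left]
  have hz : ∀ t ∈ uIcc 0 H, shadowDensity r θlow α β T t *
      (∫ θ in {θ : I | t < revealTime α β T θ}, agentU r θ (revealTime α β T θ) ∂prior μ -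
        Real.exp (-r * t) * ∫ θ in {θ : I | t < revealTime α β T θ}, (θ : ℝ) ∂prior μ) = 0 := by
    intro t ht
    rw [uIcc_of_le hH0] at ht
    lift t to ℝ≥0 using ht.1
    have h := hS.setIntegral_silent_agentU hc hp h1 hr t
    rw [hS.silent_eq] at h
    simp only [NNReal.coe_lt_coe]
    rw [h, sub_self, mul_zero]
  rw [intervalIntegral.integral_congr hz, intervalIntegral.integral_zero]

/-- Weak duality: no obedient policy gives the principal more than tail-censorship. -/
theorem principalPayoff_le (hS : IsSilenceCurve μ r α β T) (hc : Continuous μ)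
    (hp : ∀ x, 0 < μ x) (h1 : cdf μ 1 = 1) (hr : 0 < r) (hlow0 : 0 ≤ θlow) (hlow : θlow ≤ β 0)
    (hinit : β 0 = θlow ∨ α 0 = 1 / 2 ∨ β 0 = 1 / 2) {H : ℝ≥0} (hH : T ≤ H)
    {Ω : Type u} {mΩ : MeasurableSpace Ω} {P : Measure Ω} {ℱ : Filtration ℝ≥0 mΩ}
    {X : ℝ≥0 → Ω → Measure I} {τ : Ω → ℝ≥0} (hX : IsPersuasionStrategy (prior μ) P ℱ X)
    (hτ : IsObedient r H P ℱ X τ) :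
    principalPayoff θlow P X τ ≤
      principalPayoff θlow (prior μ) (tailBelief (prior μ) α β T) (revealTime α β T) := by
  obtain ⟨p, hp0, hp1, hslack⟩ := hS.exists_initial_slack hc hp h1 hr hinit
  have hP := hX.isProbabilityMeasure
  have hH0 : (0 : ℝ) ≤ H := H.2
  set ρ₀ := shadowMass r θlow β T 0 with hρ₀
  have hρ₀0 : 0 ≤ ρ₀ := hS.shadowMass_nonneg hr hlow le_rfl
  set w := shadowDensity r θlow α β T with hw
  have hw0 : ∀ t, 0 ≤ t → 0 ≤ w t := fun t ht => hS.shadowDensity_nonneg hlow0 hlow ht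
  have hwi : IntervalIntegrable w volume 0 H := hS.intervalIntegrable_shadowDensity hr hlow0 hH
  have hτm := hτ.1.measurable
  have hτI : ∀ ω, (τ ω : ℝ) ∈ Icc 0 (H : ℝ) := fun ω =>
    ⟨NNReal.coe_nonneg _, NNReal.coe_le_coe.2 (hτ.1.2 ω)⟩
  obtain ⟨hint, heq⟩ := integral_lagrangian (P := P) (θlow := θlow) (p := p) (mass := ρ₀) hr hH0
    hwi (hX.measurable_mean_stopped hτm) (fun ω => hX.mean_mem (τ ω) ω) hτm.coe_nnreal_real hτI
  -- The Lagrangian exceeds the payoff, since all weighted slacks are nonnegative.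
  have hslack1 : 0 ≤ ρ₀ * (∫ ω, agentU r (mean (X (τ ω) ω)) (τ ω) ∂P -
      ∫ ω, (p * mean (X (τ ω) ω) + (1 - p) / 2) ∂P) :=
    mul_nonneg hρ₀0 (sub_nonneg.2 (IsObedient.initial_le hX hr hτ hp0 hp1))
  have hslack2 : 0 ≤ ∫ t in (0 : ℝ)..H, w t *
      (∫ ω in {ω | t < (τ ω : ℝ)}, agentU r (mean (X (τ ω) ω)) (τ ω) ∂P -
        Real.exp (-r * t) * ∫ ω in {ω | t < (τ ω : ℝ)}, mean (X (τ ω) ω) ∂P) := by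
    refine intervalIntegral.integral_nonneg hH0 fun t ht => mul_nonneg (hw0 t ht.1) ?_
    lift t to ℝ≥0 using ht.1
    exact sub_nonneg.2 (IsObedient.continuation_le hX hr hτ t)
  -- The maximised Lagrangian as a test function.
  have hLip : ∃ K, ∀ t ∈ Icc 0 (H : ℝ), ∀ m m' : ℝ,
      lagrangian r θlow p ρ₀ w m t ≤ lagrangian r θlow p ρ₀ w m' t + K * |m - m'| :=
    exists_lipschitz_lagrangian hH0 hwi
  obtain ⟨K, hK⟩ := hLip
  set h : I → ℝ := fun θ => lagrangian r θlow p ρ₀ w θ (revealTime α β T θ) with hh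
  have hmax : ∀ θ : I, ∀ t ∈ Icc 0 (H : ℝ), lagrangian r θlow p ρ₀ w θ t ≤ h θ := fun θ t ht =>
    hS.lagrangian_le_revealTime hr hlow0 hH p θ ht
  have hrevI : ∀ θ, (revealTime α β T θ : ℝ) ∈ Icc 0 (H : ℝ) := fun θ =>
    ⟨NNReal.coe_nonneg _, (hS.revealTime_le θ).trans hH⟩
  have hone : ∀ θ θ' : I, h θ - h θ' ≤ K * |(θ : ℝ) - θ'| := fun θ θ' => by
    have e1 := hK _ (hrevI θ) θ θ'
    have e2 := hmax θ' _ (hrevI θ)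
    simp only [hh] at e2 ⊢
    linarith
  have hcont : Continuous h := by
    have hK' : ∀ θ θ' : I, |h θ - h θ'| ≤ |K| * |(θ : ℝ) - θ'| := fun θ θ' => by
      have hle : K * |(θ : ℝ) - θ'| ≤ |K| * |(θ : ℝ) - θ'| :=
        mul_le_mul_of_nonneg_right (le_abs_self K) (abs_nonneg _)
      have e2 := hone θ' θ
      rw [abs_sub_comm] at e2
      exact abs_le.2 ⟨by linarith, (hone θ θ').trans hle⟩
    exact (LipschitzWith.of_dist_le_mul (K := ‖K‖₊) fun θ θ' => hK' θ θ').continuous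
  let φ : C(I, ℝ) := ⟨h, hcont⟩
  have hpoint : ∀ ω, lagrangian r θlow p ρ₀ w (mean (X (τ ω) ω)) (τ ω) ≤
      ∫ θ, φ θ ∂(X (τ ω) ω) := fun ω => by
    have := hX.isBelief (τ ω) ω
    refine (lagrangian_mean_le hρ₀0 (hτI ω).1 (fun s hs => hw0 s hs.1) _).trans ?_
    refine integral_mono ?_ (hcont.integrable_of_hasCompactSupport
      (HasCompactSupport.of_compactSpace _)) fun θ => hmax θ _ (hτI ω)
    have : Continuous fun θ : I => lagrangian r θlow p ρ₀ w θ (τ ω) := by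
      simp only [lagrangian_eq_affine]
      fun_prop
    exact this.integrable_of_hasCompactSupport (HasCompactSupport.of_compactSpace _)
  have hφint : Integrable (fun ω => ∫ θ, φ θ ∂(X (τ ω) ω)) P :=
    Integrable.of_bound (hX.measurable_integral_stopped φ hτm).aestronglyMeasurable ‖φ‖
      (ae_of_all _ fun ω => hX.abs_integral_le φ _ ω)
  calc principalPayoff θlow P X τ
      ≤ ∫ ω, lagrangian r θlow p ρ₀ w (mean (X (τ ω) ω)) (τ ω) ∂P := by
        rw [heq, principalPayoff]
        linarith
    _ ≤ ∫ ω, ∫ θ, φ θ ∂(X (τ ω) ω) ∂P := integral_mono hint hφint hpoint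
    _ = ∫ θ, φ θ ∂prior μ := hX.integral_stopped hτ.1 φ
    _ = _ := by
        rw [hS.principalPayoff_revealTime]
        exact hS.integral_lagrangian_revealTime hc hp h1 hr hlow0 hH hslack

theorem isOptimalPolicy (hS : IsSilenceCurve μ r α β T) (hc : Continuous μ)
    (hp : ∀ x, 0 < μ x) (h1 : cdf μ 1 = 1) (hr : 0 < r) (hlow0 : 0 ≤ θlow) (hlow : θlow ≤ β 0)
    (hinit : β 0 = θlow ∨ α 0 = 1 / 2 ∨ β 0 = 1 / 2) {H : ℝ≥0} (hH : T ≤ H) :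
    IsOptimalPolicy.{u} (prior μ) r θlow H (prior μ) (tailFiltration (prior μ) α β T)
      (tailBelief (prior μ) α β T) (revealTime α β T) :=
  ⟨hS.isPersuasionStrategy hc hp h1, hS.isObedient hc hp h1 hr hH,
    fun _ _ _ _ _ _ hX hτ => hS.principalPayoff_le hc hp h1 hr hlow0 hlow hinit hH hX hτ⟩

end IsSilenceCurve

/-- The result for a density that is continuous and positive on the whole line; only its values on
`[0,1]` matter. -/
theorem exists_optimal_tailCensorship {μ : ℝ → ℝ} (hc : Continuous μ) (hp : ∀ x, 0 < μ x)
    (h1 : cdf μ 1 = 1) {r : ℝ} (hr : 0 < r) :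
    ∃ θs ∈ Icc (1 / 2 : ℝ) ((1 + firstMoment μ (1 / 2)) / (1 + cdf μ (1 / 2))),
      ∀ θlow : ℝ, 0 ≤ θlow → θlow < 1 → ∃ (T : ℝ) (α β : ℝ → ℝ),
        IsSilenceCurve μ r α β T ∧ β 0 = max θlow θs ∧
        ∀ H : ℝ≥0, T ≤ H → IsOptimalPolicy.{u} (prior μ) r θlow H (prior μ)
          (tailFiltration (prior μ) α β T) (tailBelief (prior μ) α β T) (revealTime α β T) := by
  obtain ⟨θs, hθs, hθs1, hneg, hθs0⟩ := exists_threshold hc hp h1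
  refine ⟨θs, hθs, fun θlow hlow0 hlow1 => ?_⟩
  have hb1 : max θlow θs < 1 := max_lt hlow1 hθs1
  have hb : tailExcess μ (1 / 2) (max θlow θs) ≤ 0 :=
    (tailExcess_antitoneOn_right hc hp h1 (by norm_num) hθs1.le hb1.le (le_max_right _ _)).trans
      hneg
  obtain ⟨T, α, β, hS, hβ0, hα0⟩ := exists_silenceCurve hc hp h1 hr
    (hθs.1.trans (le_max_right _ _)) hb1 hb
  refine ⟨T, α, β, hS, hβ0, fun H hH => hS.isOptimalPolicy hc hp h1 hr hlow0
    (hβ0 ▸ le_max_left _ _) ?_ hH⟩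
  rcases le_total θs θlow with h | h
  · exact Or.inl (hβ0.trans (max_eq_left h))
  · rw [max_eq_right h] at hβ0 hα0
    rcases hθs0 with h0 | h0
    · exact Or.inr (Or.inr (hβ0.trans h0))
    · exact Or.inr (Or.inl (hα0 h0))

end CentralBank

theorem proposition5 (μ : ℝ → ℝ) (hμ_cont : ContinuousOn μ (Set.Icc 0 1))
    (hμ_pos : ∀ x ∈ Set.Icc (0 : ℝ) 1, 0 < μ x) (hμ_one : (∫ x in (0 : ℝ)..1, μ x) = 1)
    (r : ℝ) (hr : 0 < r) :
    ∃ θstar ∈ Set.Icc (1 / 2 : ℝ)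
        ((1 + (∫ x in (0 : ℝ)..(1 / 2), x * μ x)) / (1 + CentralBank.cdf μ (1 / 2))),
      ∀ θlow : ℝ, 0 ≤ θlow → θlow < 1 →
        ∃ (Tbar : ℝ) (α β : ℝ → ℝ), 0 < Tbar ∧
          CentralBank.IsExpandingInterval α β Tbar ∧
          CentralBank.SolvesSystem μ r α β Tbar ∧
          α Tbar = 0 ∧ β Tbar = 1 ∧ β 0 = max θlow θstar ∧
          ∀ H : NNReal, Tbar ≤ H →
            CentralBank.IsOptimalPolicy.{u} (CentralBank.prior μ) r θlow H
              (CentralBank.prior μ)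
              (CentralBank.tailFiltration (CentralBank.prior μ) α β Tbar)
              (CentralBank.tailBelief (CentralBank.prior μ) α β Tbar)
              (CentralBank.revealTime α β Tbar) := by
  set ν : ℝ → ℝ := fun x => μ (projIcc 0 1 zero_le_one x) with hν
  have hνμ : ∀ x ∈ Icc (0 : ℝ) 1, ν x = μ x := fun x hx => by
    simp only [hν, projIcc_of_mem zero_le_one hx]
  have hc : Continuous ν := hμ_cont.comp_continuous (continuous_subtype_val.comp
    continuous_projIcc) fun x => (projIcc 0 1 zero_le_one x).2
  have hp : ∀ x, 0 < ν x := fun x => hμ_pos _ (projIcc 0 1 zero_le_one x).2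
  have hcdf : ∀ x ∈ Icc (0 : ℝ) 1, CentralBank.cdf ν x = CentralBank.cdf μ x := fun x hx =>
    intervalIntegral.integral_congr fun z hz => by
      rw [uIcc_of_le hx.1] at hz
      exact hνμ z ⟨hz.1, hz.2.trans hx.2⟩
  have hhalf : (1 / 2 : ℝ) ∈ Icc (0 : ℝ) 1 := by constructor <;> norm_num
  have hone : CentralBank.cdf ν 1 = 1 := (hcdf 1 ⟨zero_le_one, le_rfl⟩).trans hμ_one
  have hfm : CentralBank.firstMoment ν (1 / 2) = ∫ x in (0 : ℝ)..(1 / 2), x * μ x :=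
    intervalIntegral.integral_congr fun z hz => by
      rw [uIcc_of_le hhalf.1] at hz
      rw [hνμ z ⟨hz.1, hz.2.trans hhalf.2⟩]
  have hprior : CentralBank.prior ν = CentralBank.prior μ := by
    simp only [CentralBank.prior]
    congr 1
    funext θ
    rw [hνμ θ θ.2]
  obtain ⟨θs, hθs, H⟩ := CentralBank.exists_optimal_tailCensorship.{u} hc hp hone hr
  rw [hcdf _ hhalf, hfm] at hθs
  refine ⟨θs, hθs, fun θlow h0 hlt => ?_⟩
  obtain ⟨T, α, β, hS, hβ0, hopt⟩ := H θlow h0 hlt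
  rw [hprior] at hopt
  refine ⟨T, α, β, hS.pos, hS.expanding, ⟨hS.solves.1, fun t ht hlt => ?_⟩, hS.lower_end,
    hS.upper_end, hβ0, hopt⟩
  have ho := hS.expanding.ordered t ht
  have hα : α t ∈ Icc (0 : ℝ) 1 := ⟨ho.1, ho.2.1.trans ho.2.2⟩
  have hβ : β t ∈ Icc (0 : ℝ) 1 := ⟨ho.1.trans ho.2.1, ho.2.2⟩
  have h := hS.solves.2 t ht hlt
  rwa [hcdf _ hα, hcdf _ hβ, hνμ _ hα] at h
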